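/- Let $F$ be a field of characteristic $2$. A quadratic form $\varphi$ on a finite-dimensional vector space $V$ over a field $K$ of characteristic $2$ is called quasilinear if $\varphi(v+w)=\varphi(v)+\varphi(w)$ for all $v,w\in V$, and anisotropic if $\varphi(v)\neq 0$ for all $v\neq 0$. Its isotropy index $\mathfrak{i}_0(\varphi)$ is the maximal dimension of a subspace of $V$ on which $\varphi$ vanishes. If $\varphi$ is quasilinear, its isotropic vectors form a subspace $U$ of $V$; the anisotropic part $\varphi_{\mathrm{an}}$ is the form induced by $\varphi$ on $V/U$, and (for $\varphi\neq 0$) the divisibility index $\mathfrak{d}_0(\varphi)$ is the largest integer $s\ge 0$ such that $\varphi_{\mathrm{an}}\simeq\pi\otimes\rho$ for some $s$-fold quasi-Pfister form $\pi=\langle 1,-a_1\rangle\otimes\cdots\otimes\langle 1,-a_s\rangle$ with $a_1,\dots,a_s\in K^*$ ($\pi=\langle 1\rangle$ for $s=0$) and some quasilinear form $\rho$ over $K$. Let $p$ and $q$ be anisotropic quasilinear quadratic forms of dimension $\ge 2$ over $F$. Let $F(p)$ be the function field of the (integral) projective quadric $\{p=0\}$, and let $p_{F(p)}$, $q_{F(p)}$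 be the forms obtained from $p$, $q$ by scalar extension to $F(p)$. Put $\mathfrak{i}_1(p)=\mathfrak{i}_0(p_{F(p)})$, $p_1=(p_{F(p)})_{\mathrm{an}}$ and $\mathfrak{d}_1(p)=\mathfrak{d}_0(p_1)$. Then $\dim(p)-\mathfrak{i}_1(p)=\dim(p_1)$ is a positive integer, and, writing $s=v_2\big(\dim(p)-\mathfrak{i}_1(p)\big)$ for its $2$-adic order, the following hold: 1. $2^{\mathfrak{d}_1(p)}\ge\mathfrak{i}_1(p)$; 2. $\mathfrak{i}_0(q_{F(p)})\le\max\big(\dim(q)-\dim(p)+\mathfrak{i}_1(p)-2^{\mathfrak{d}_1(p)},\ 2^{\mathfrak{d}_1(p)}\big)$; 3. $\mathfrak{i}_0(q_{F(p)})\le\max\big(\dim(q)-\dim(p),\ 2^{\mathfrak{d}_1(p)}\big)\le\max\big(\dim(q)-\dim(p),\ 2^{s}\big)$. -/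

import Mathlib

open scoped TensorProduct

namespace QuasilinearForms

section Basic

variable {K : Type*} [Field K] {V : Type*} [AddCommGroup V] [Module K V]

/-- A quadratic form is quasilinear if it is additive. In characteristic `2` these are exactly the
diagonalizable quadratic forms. -/
def IsQuasilinear (φ : QuadraticForm K V) : Prop :=
  ∀ v w : V, φ (v + w) = φ v + φ w

/-- The isotropy index of `φ`: the maximal dimension of a subspace on which `φ` vanishes. -/
noncomputable def isotropyIndex (φ : QuadraticForm K V) : ℕ :=
  sSup {n : ℕ | ∃ U : Submodule K V, (∀ u ∈ U, φ u = 0) ∧ Module.finrank K U = n}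

/-- The anisotropic part of a quasilinear form `φ`: the form induced by `φ` on the quotient of `V`
by the subspace of isotropic vectors. For quasilinear `φ` this subspace is `φ.radical`
(see `mem_radical_iff_of_isQuasilinear`); the definition is used for quasilinear forms only. -/
noncomputable def anisPart (φ : QuadraticForm K V) : QuadraticForm K (V ⧸ φ.radical) :=
  φ.lift φ.radical le_rfl

theorem mem_radical_iff_of_isQuasilinear {φ : QuadraticForm K V} (h : IsQuasilinear φ) (v : V) :
    v ∈ φ.radical ↔ φ v = 0 := by
  rw [QuadraticMap.mem_radical_iff']
  exact ⟨fun h' => h'.1, fun h' => ⟨h', fun n => by rw [h, h', zero_add]⟩⟩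

theorem anisPart_anisotropic {φ : QuadraticForm K V} (h : IsQuasilinear φ) :
    (anisPart φ).Anisotropic := by
  intro x hx
  induction x using Submodule.Quotient.induction_on with
  | _ v =>
    rw [Submodule.Quotient.mk_eq_zero, mem_radical_iff_of_isQuasilinear h]
    exact hx

end Basic

section BaseChange

variable {F : Type*} [Field F] {V : Type*} [AddCommGroup V] [Module F V] [FiniteDimensional F V]
  (L : Type*) [Field L] [Algebra F L]

/-- Scalar extension `q_L` of a quadratic form `q` to a field extension `L / F`. The form `q` is
written as `v ↦ B(v, v)` for a (not necessarily symmetric) bilinear form `B`, and `q_L` is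
`x ↦ B_L(x, x)`. This is the unique quadratic form on `L ⊗ V` which extends `q` and whose polar
form extends that of `q` (see `baseChange_tmul`, `polar_baseChange`, `eq_baseChange`), so that the
choice of `B` is immaterial; Mathlib's own base change is restricted to characteristic `≠ 2`. -/
noncomputable def baseChange (q : QuadraticForm F V) : QuadraticForm L (L ⊗[F] V) :=
  LinearMap.BilinMap.toQuadraticMap
    (LinearMap.BilinForm.baseChange L (q.toBilin (Module.finBasis F V)))

theorem toBilin_self (q : QuadraticForm F V) (v : V) :
    q.toBilin (Module.finBasis F V) v v = q v := by
  conv_rhs => rw [← QuadraticMap.toQuadraticMap_toBilin q (Module.finBasis F V)]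
  rfl

theorem toBilin_add_flip (q : QuadraticForm F V) (v w : V) :
    q.toBilin (Module.finBasis F V) v w + q.toBilin (Module.finBasis F V) w v =
      QuadraticMap.polar q v w := by
  simp only [QuadraticMap.polar, ← toBilin_self q, map_add, LinearMap.add_apply]
  ring

theorem baseChange_tmul (q : QuadraticForm F V) (a : L) (v : V) :
    baseChange L q (a ⊗ₜ[F] v) = a ^ 2 * algebraMap F L (q v) := by
  simp only [baseChange, LinearMap.BilinMap.toQuadraticMap_apply,
    LinearMap.BilinForm.baseChange_tmul, toBilin_self, Algebra.smul_def]
  ring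

theorem polar_baseChange (q : QuadraticForm F V) (a b : L) (v w : V) :
    QuadraticMap.polar (baseChange L q) (a ⊗ₜ[F] v) (b ⊗ₜ[F] w) =
      a * b * algebraMap F L (QuadraticMap.polar q v w) := by
  rw [baseChange, LinearMap.BilinMap.polar_toQuadraticMap, LinearMap.BilinForm.baseChange_tmul,
    LinearMap.BilinForm.baseChange_tmul, ← toBilin_add_flip]
  simp only [Algebra.smul_def, map_add]
  ring

theorem eq_baseChange (q : QuadraticForm F V) (φ : QuadraticForm L (L ⊗[F] V))
    (h₁ : ∀ v, φ (1 ⊗ₜ[F] v) = algebraMap F L (q v))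
    (h₂ : ∀ v w, QuadraticMap.polar φ (1 ⊗ₜ[F] v) (1 ⊗ₜ[F] w) =
      algebraMap F L (QuadraticMap.polar q v w)) :
    φ = baseChange L q := by
  have h1 : ∀ (a : L) (v : V), a ⊗ₜ[F] v = a • ((1 : L) ⊗ₜ[F] v) := fun a v => by
    rw [TensorProduct.smul_tmul', smul_eq_mul, mul_one]
  have hp : φ.polarBilin = (baseChange L q).polarBilin := by
    ext v w
    simp [h₂, polar_baseChange]
  have hp' : ∀ x y, QuadraticMap.polar φ x y = QuadraticMap.polar (baseChange L q) x y :=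
    fun x y => by simpa using congr($hp x y)
  refine QuadraticMap.ext fun x => ?_
  induction x using TensorProduct.induction_on with
  | zero => simp
  | tmul a v =>
    rw [h1, QuadraticMap.map_smul, QuadraticMap.map_smul, h₁, baseChange_tmul]
    simp
  | add x y hx hy => rw [QuadraticMap.map_add φ, QuadraticMap.map_add (baseChange L q), hx, hy, hp']

end BaseChange

section Divisibility

variable {K : Type*} [Field K] {V W : Type*} [AddCommGroup V] [Module K V] [FiniteDimensional K V]
  [AddCommGroup W] [Module K W] [FiniteDimensional K W]

/-- The tensor product of two quasilinear forms: the quasilinear form on `V ⊗ W` with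
`v ⊗ w ↦ φ(v) ψ(w)` (see `tensor_tmul`, `isQuasilinear_tensor`). It is used for quasilinear forms in
characteristic `2` only; Mathlib's tensor product is restricted to characteristic `≠ 2`. -/
noncomputable def tensor (φ : QuadraticForm K V) (ψ : QuadraticForm K W) :
    QuadraticForm K (V ⊗[K] W) :=
  LinearMap.BilinMap.toQuadraticMap
    (LinearMap.BilinForm.tmul (φ.toBilin (Module.finBasis K V)) (ψ.toBilin (Module.finBasis K W)))

theorem tensor_tmul (φ : QuadraticForm K V) (ψ : QuadraticForm K W) (v : V) (w : W) :
    tensor φ ψ (v ⊗ₜ[K] w) = φ v * ψ w := by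
  simp only [tensor, LinearMap.BilinMap.toQuadraticMap_apply,
    LinearMap.BilinForm.tensorDistrib_tmul, toBilin_self, smul_eq_mul]
  ring

theorem isQuasilinear_tensor [CharP K 2] {φ : QuadraticForm K V} {ψ : QuadraticForm K W}
    (hφ : IsQuasilinear φ) (hψ : IsQuasilinear ψ) : IsQuasilinear (tensor φ ψ) := by
  have hc : ∀ a b : K, a + b = 0 → a = b := fun a b h => by
    rw [← sub_eq_zero, CharTwo.sub_eq_add]; exact h
  have e₁ : ∀ v w, φ.toBilin (Module.finBasis K V) v w = φ.toBilin (Module.finBasis K V) w v :=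
    fun v w => hc _ _ (by rw [toBilin_add_flip, QuadraticMap.polar, hφ]; ring)
  have e₂ : ∀ v w, ψ.toBilin (Module.finBasis K W) v w = ψ.toBilin (Module.finBasis K W) w v :=
    fun v w => hc _ _ (by rw [toBilin_add_flip, QuadraticMap.polar, hψ]; ring)
  have hs := LinearMap.IsSymm.tmul (B₁ := φ.toBilin (Module.finBasis K V))
    (B₂ := ψ.toBilin (Module.finBasis K W)) ⟨e₁⟩ ⟨e₂⟩
  intro x y
  have := hs.eq x y
  simp only [RingHom.id_apply] at this
  simp only [tensor, LinearMap.BilinMap.toQuadraticMap_apply, map_add, LinearMap.add_apply]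
  rw [this]
  linear_combination CharTwo.add_self_eq_zero
    (LinearMap.BilinForm.tmul (φ.toBilin (Module.finBasis K V))
      (ψ.toBilin (Module.finBasis K W)) y x)

/-- The `s`-fold (quasi-)Pfister form `⟪a₁, …, aₛ⟫ = ⟨1, -a₁⟩ ⊗ ⋯ ⊗ ⟨1, -aₛ⟩`, with the tensor
product of diagonal forms expanded: it is the diagonal form whose coefficients are the products
`∏_{i ∈ I} (-aᵢ)` for `I ⊆ {1, …, s}`. For `s = 0` it is `⟨1⟩`. -/
noncomputable def pfister {s : ℕ} (a : Fin s → Kˣ) : QuadraticForm K (Finset (Fin s) → K) :=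
  QuadraticMap.weightedSumSquares K fun I : Finset (Fin s) => ∏ i ∈ I, (-(a i : K))

/-- `φ` is divisible by `π`: there is a quasilinear form `ρ` (on a finite-dimensional space, which
may be taken to be some `K ^ m`) such that `φ ≃ π ⊗ ρ`. -/
def IsDivisibleBy (φ : QuadraticForm K V) (π : QuadraticForm K W) : Prop :=
  ∃ (m : ℕ) (ρ : QuadraticForm K (Fin m → K)),
    IsQuasilinear ρ ∧ QuadraticMap.Equivalent φ (tensor π ρ)

/-- The divisibility index `𝔡₀(φ)`: the largest `s` such that the anisotropic part of `φ` is
divisible by an `s`-fold quasi-Pfister form. -/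
noncomputable def divisibilityIndex (φ : QuadraticForm K V) : ℕ :=
  sSup {s : ℕ | ∃ a : Fin s → Kˣ, IsDivisibleBy (anisPart φ) (pfister a)}

end Divisibility

section FunctionField

variable {F : Type*} [Field F] {V : Type*} [AddCommGroup V] [Module F V] [FiniteDimensional F V]

/-- The quadratic form `p`, written as a homogeneous polynomial of degree `2` in the coordinates
with respect to a basis of `V` (see `eval_formPoly`). -/
noncomputable def formPoly (p : QuadraticForm F V) :
    MvPolynomial (Fin (Module.finrank F V)) F :=
  ∑ i, ∑ j, MvPolynomial.C (p.toBilin (Module.finBasis F V) (Module.finBasis F V i)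
    (Module.finBasis F V j)) * (MvPolynomial.X i * MvPolynomial.X j)

theorem eval_formPoly (p : QuadraticForm F V) (x : Fin (Module.finrank F V) → F) :
    MvPolynomial.eval x (formPoly p) = p (∑ i, x i • Module.finBasis F V i) := by
  rw [← toBilin_self p]
  simp only [formPoly, map_sum, map_mul, MvPolynomial.eval_C, MvPolynomial.eval_X,
    LinearMap.sum_apply, map_smul, LinearMap.smul_apply, smul_eq_mul, Finset.mul_sum]
  refine (Finset.sum_comm).trans (Finset.sum_congr rfl fun i _ => Finset.sum_congr rfl fun j _ => ?_)
  ring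

theorem isHomogeneous_formPoly (p : QuadraticForm F V) : (formPoly p).IsHomogeneous 2 := by
  refine MvPolynomial.IsHomogeneous.sum _ _ _ fun i _ => MvPolynomial.IsHomogeneous.sum _ _ _
    fun j _ => ?_
  exact ((MvPolynomial.isHomogeneous_X F i).mul (MvPolynomial.isHomogeneous_X F j)).C_mul _

theorem exists_eval_eq_zero {n : ℕ} (hn : 2 ≤ n) {f : MvPolynomial (Fin n) F}
    (hf : f.IsHomogeneous 1) : ∃ x : Fin n → F, x ≠ 0 ∧ MvPolynomial.eval x f = 0 := by
  have hL : ∃ L : (Fin n → F) →ₗ[F] F, ∀ x, MvPolynomial.eval x f = L x := by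
    have hf' : f ∈ MvPolynomial.homogeneousSubmodule (Fin n) F 1 := hf
    rw [MvPolynomial.homogeneousSubmodule_one_eq_span_X] at hf'
    clear hf
    induction hf' using Submodule.span_induction with
    | mem g hg =>
      obtain ⟨i, rfl⟩ := hg
      exact ⟨LinearMap.proj i, fun x => by simp⟩
    | zero => exact ⟨0, fun x => by simp⟩
    | add g h _ _ hg hh =>
      obtain ⟨L, hL⟩ := hg
      obtain ⟨M, hM⟩ := hh
      exact ⟨L + M, fun x => by simp [hL, hM]⟩
    | smul a g _ hg =>
      obtain ⟨L, hL⟩ := hg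
      exact ⟨a • L, fun x => by simp [hL, MvPolynomial.smul_eval]⟩
  obtain ⟨L, hL⟩ := hL
  have : LinearMap.ker L ≠ ⊥ := LinearMap.ker_ne_bot_of_finrank_lt (by simpa using Nat.lt_of_lt_of_le one_lt_two hn)
  obtain ⟨x, hx, hx0⟩ := (Submodule.ne_bot_iff _).1 this
  exact ⟨x, hx0, by rw [hL]; exact hx⟩

theorem irreducible_formPoly (p : QuadraticForm F V) (hp : p.Anisotropic)
    (hd : 2 ≤ Module.finrank F V) : Irreducible (formPoly p) := by
  have key : ∀ x : Fin (Module.finrank F V) → F, x ≠ 0 → MvPolynomial.eval x (formPoly p) ≠ 0 := by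
    intro x hx h
    rw [eval_formPoly] at h
    apply hx
    have h0 := hp _ h
    ext i
    simpa using Fintype.linearIndependent_iff.1 (Module.finBasis F V).linearIndependent x h0 i
  have hne : formPoly p ≠ 0 := by
    intro h
    refine key (fun _ => 1) (fun h' => ?_) (by rw [h, map_zero])
    exact one_ne_zero (congrFun h' ⟨0, by omega⟩)
  have hdeg := (isHomogeneous_formPoly p).totalDegree hne
  refine ⟨fun hu => ?_, fun f g hfg => ?_⟩
  · have := MvPolynomial.isUnit_iff_totalDegree_of_isReduced.1 hu
    omega
  have hf0 : f ≠ 0 := by rintro rfl; simp at hfg; exact hne hfg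
  have hg0 : g ≠ 0 := by rintro rfl; simp at hfg; exact hne hfg
  have hadd : f.totalDegree + g.totalDegree = 2 := by
    rw [← MvPolynomial.totalDegree_mul_of_isDomain hf0 hg0, ← hfg, hdeg]
  have unit : ∀ h : MvPolynomial (Fin (Module.finrank F V)) F, h ≠ 0 → h.totalDegree = 0 →
      IsUnit h := by
    intro h h0 h1
    have hC := MvPolynomial.totalDegree_eq_zero_iff_eq_C.1 h1
    rw [hC]
    refine IsUnit.map _ (isUnit_iff_ne_zero.2 fun h' => h0 ?_)
    rw [hC, h', map_zero]
  rcases Nat.lt_or_ge f.totalDegree 1 with h1 | h1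
  · exact Or.inl (unit f hf0 (by omega))
  rcases Nat.lt_or_ge g.totalDegree 1 with h2 | h2
  · exact Or.inr (unit g hg0 (by omega))
  exfalso
  have split : ∀ h : MvPolynomial (Fin (Module.finrank F V)) F, h.totalDegree = 1 →
      h = h.homogeneousComponent 0 + h.homogeneousComponent 1 := by
    intro h hh
    have := MvPolynomial.sum_homogeneousComponent h
    rw [hh] at this
    simpa [Finset.sum_range_succ] using this.symm
  set f0 := f.homogeneousComponent 0
  set f1 := f.homogeneousComponent 1
  set g0 := g.homogeneousComponent 0
  set g1 := g.homogeneousComponent 1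
  have hf0' : f0.IsHomogeneous 0 := MvPolynomial.homogeneousComponent_isHomogeneous 0 f
  have hf1' : f1.IsHomogeneous 1 := MvPolynomial.homogeneousComponent_isHomogeneous 1 f
  have hg0' : g0.IsHomogeneous 0 := MvPolynomial.homogeneousComponent_isHomogeneous 0 g
  have hg1' : g1.IsHomogeneous 1 := MvPolynomial.homogeneousComponent_isHomogeneous 1 g
  have e : formPoly p = f0 * g0 + f0 * g1 + f1 * g0 + f1 * g1 := by
    rw [hfg, split f (by omega), split g (by omega)]
    ring
  have comp : ∀ (m : ℕ) (h : MvPolynomial (Fin (Module.finrank F V)) F), h.IsHomogeneous m →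
      h.homogeneousComponent 2 = if m = 2 then h else 0 := by
    intro m h hh
    rw [MvPolynomial.homogeneousComponent_of_mem hh]
    simp [eq_comm]
  have e2 : formPoly p = f1 * g1 := by
    have := congrArg (MvPolynomial.homogeneousComponent 2) e
    simp only [map_add] at this
    rw [comp 2 _ (isHomogeneous_formPoly p), comp _ _ (hf0'.mul hg0'), comp _ _ (hf0'.mul hg1'),
      comp _ _ (hf1'.mul hg0'), comp _ _ (hf1'.mul hg1')] at this
    simpa using this
  obtain ⟨x, hx, hx'⟩ := exists_eval_eq_zero hd hf1'
  exact key x hx (by rw [e2, map_mul, hx', zero_mul])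

/-- The homogeneous coordinate ring `F[T₁, …, Tₙ] / (p)` of the projective quadric `{p = 0}`. -/
abbrev CoordinateRing (p : QuadraticForm F V) : Type _ :=
  MvPolynomial (Fin (Module.finrank F V)) F ⧸ Ideal.span {formPoly p}

theorem isDomain_coordinateRing (p : QuadraticForm F V) (hp : p.Anisotropic)
    (hd : 2 ≤ Module.finrank F V) : IsDomain (CoordinateRing p) := by
  have hprime := (irreducible_formPoly p hp hd).prime
  have : (Ideal.span {formPoly p}).IsPrime :=
    (Ideal.span_singleton_prime hprime.ne_zero).2 hprime
  exact Ideal.Quotient.isDomain _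

/-- The function field `F[p]` of the affine cone `{p = 0}`, for `p` anisotropic of dimension
`≥ 2`: the field of fractions of the homogeneous coordinate ring. The hypotheses on `p` are
recorded in the type because they make the ring an integral domain. -/
def AffineFunctionField (p : QuadraticForm F V) (_hp : p.Anisotropic)
    (_hd : 2 ≤ Module.finrank F V) : Type _ :=
  FractionRing (CoordinateRing p)

noncomputable instance (p : QuadraticForm F V) (hp : p.Anisotropic)
    (hd : 2 ≤ Module.finrank F V) : Field (AffineFunctionField p hp hd) :=
  haveI := isDomain_coordinateRing p hp hd
  inferInstanceAs (Field (FractionRing (CoordinateRing p)))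

noncomputable instance (p : QuadraticForm F V) (hp : p.Anisotropic)
    (hd : 2 ≤ Module.finrank F V) : Algebra F (AffineFunctionField p hp hd) :=
  inferInstanceAs (Algebra F (FractionRing (CoordinateRing p)))

/-- The class of the `i`-th coordinate function `Tᵢ` in `F[p]`. -/
noncomputable def coord (p : QuadraticForm F V) (hp : p.Anisotropic)
    (hd : 2 ≤ Module.finrank F V) (i : Fin (Module.finrank F V)) : AffineFunctionField p hp hd :=
  algebraMap (CoordinateRing p) (FractionRing (CoordinateRing p))
    (Ideal.Quotient.mk _ (MvPolynomial.X i))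

/-- The function field `F(p)` of the projective quadric `{p = 0}`: the subfield of `F[p]` generated
over `F` by the ratios `Tᵢ / Tⱼ` of coordinates. -/
noncomputable def functionField (p : QuadraticForm F V) (hp : p.Anisotropic)
    (hd : 2 ≤ Module.finrank F V) : IntermediateField F (AffineFunctionField p hp hd) :=
  IntermediateField.adjoin F {z | ∃ i j, z = coord p hp hd i / coord p hp hd j}

/-- The first higher isotropy index `𝔦₁(p) = 𝔦₀(p_{F(p)})` of an anisotropic form `p`. -/
noncomputable def firstIsotropyIndex (p : QuadraticForm F V) (hp : p.Anisotropic)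
    (hd : 2 ≤ Module.finrank F V) : ℕ :=
  isotropyIndex (baseChange (functionField p hp hd) p)

/-- The first higher divisibility index `𝔡₁(p) = 𝔡₀(p₁)` of an anisotropic quasilinear form `p`,
where `p₁` is the anisotropic part of `p_{F(p)}`. -/
noncomputable def firstDivisibilityIndex (p : QuadraticForm F V) (hp : p.Anisotropic)
    (hd : 2 ≤ Module.finrank F V) : ℕ :=
  divisibilityIndex (anisPart (baseChange (functionField p hp hd) p))

end FunctionField

end QuasilinearForms

/-! In characteristic 2 a quasilinear form `φ` over `E` has a linear square root: an `E`-linear map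
`ρ` into an extension `Ω` with `ρ x ^ 2 = φ x`. The invariants can be read off from `ρ`. The
isotropy index is the dimension of its kernel, and the anisotropic part is carried by its range `P`.
If `N` is the field of all `x` with `x P ⊆ P`, then `2 ^ 𝔡₀(φ) = [N : E]`
(`IsSquareRoot.two_pow_divisibilityIndex`), because `N / E` is multiquadratic and `P` is a vector
space over `N`.

Now let `E = F(p)`. Over the algebraic closure `M` of `F`, `p` is the square of a linear form `l = ∑
rᵢ Tᵢ`, and `Ω = Frac (M[T] / (l))` contains `F[p]`. Let `P`, `Q` be the ranges of the square roots
`ρ`, `τ` of `p`, `q` over `E`. A vector of `ker τ` is a relation `∑ cₖ sₖ = 0` in `Ω`, where the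
`sₖ` are square roots of values of `q`; clearing denominators gives `∑ fₖ sₖ = l g`. Applying
`∂/∂Tᵢ` yields `∑ (∂ᵢ fₖ) sₖ ≡ rᵢ g` modulo `l`, so a single cofactor multiplies all `rᵢ` into
combinations of the `sₖ` (`exists_cofactor`). Since `∂ᵢ p = 0`, this takes place over `F[p]`, and
over `F(p)` after multiplication by a coordinate. The result is an embedding of `ker τ` with image
`A` such that `P A ⊆ Q` (`exists_squareRoots_functionField`).

If `dim A > [N : E]`, some quotient of elements of `A` lies outside `N`, and this forces `dim P + [N
: E] ≤ dim Q` (`finrank_add_finrank_stabilizer_le`). This dichotomy is the whole theorem: for `q =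
p` the second alternative is impossible, which bounds `𝔦₁(p)`; the other bounds are arithmetic,
together with `[N : E] ∣ dim P`. -/

namespace QuasilinearForms

/-! ### Linear square roots of quasilinear forms -/

section SquareRoot

variable {E Ω X : Type*} [Field E] [Field Ω] [Algebra E Ω] [AddCommGroup X] [Module E X]

/-- `ρ` is a linear square root of the quadratic form `φ` with values in the extension `Ω`. -/
def IsSquareRoot (φ : QuadraticForm E X) (ρ : X →ₗ[E] Ω) : Prop :=
  ∀ x, ρ x ^ 2 = algebraMap E Ω (φ x)

variable {φ : QuadraticForm E X} {ρ : X →ₗ[E] Ω}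

theorem IsSquareRoot.map_eq_zero_iff (h : IsSquareRoot φ ρ) (x : X) : φ x = 0 ↔ ρ x = 0 := by
  rw [← pow_eq_zero_iff (two_ne_zero : (2 : ℕ) ≠ 0) (a := ρ x), h x]
  simp

/-- The kernel of `ρ` consists of all isotropic vectors, so it is the largest totally isotropic
subspace. -/
theorem IsSquareRoot.isotropyIndex_eq [FiniteDimensional E X] (h : IsSquareRoot φ ρ) :
    isotropyIndex φ = Module.finrank E (LinearMap.ker ρ) := by
  refine IsGreatest.csSup_eq ⟨⟨LinearMap.ker ρ, fun u hu => ?_, rfl⟩, ?_⟩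
  · rwa [h.map_eq_zero_iff]
  · rintro _ ⟨U, hU, rfl⟩
    exact Submodule.finrank_mono fun u hu => (h.map_eq_zero_iff u).1 (hU u hu)

variable [CharP E 2]

theorem IsSquareRoot.isQuasilinear (h : IsSquareRoot φ ρ) : IsQuasilinear φ := by
  have : CharP Ω 2 := charP_of_injective_algebraMap (algebraMap E Ω).injective 2
  intro v w
  apply (algebraMap E Ω).injective
  rw [map_add (algebraMap E Ω), ← h, ← h, ← h, map_add, CharTwo.add_sq]

theorem IsSquareRoot.radical_eq_ker (h : IsSquareRoot φ ρ) : φ.radical = LinearMap.ker ρ := by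
  ext x
  rw [mem_radical_iff_of_isQuasilinear h.isQuasilinear, h.map_eq_zero_iff, LinearMap.mem_ker]

/-- A square root of `φ` induces an injective square root of the anisotropic part of `φ`, with the
same range. -/
theorem IsSquareRoot.exists_anisPart (h : IsSquareRoot φ ρ) :
    ∃ ρ' : X ⧸ φ.radical →ₗ[E] Ω, IsSquareRoot (anisPart φ) ρ' ∧ Function.Injective ρ' ∧
      LinearMap.range ρ' = LinearMap.range ρ := by
  refine ⟨φ.radical.liftQ ρ h.radical_eq_ker.le, fun x => ?_, ?_, Submodule.range_liftQ _ _ _⟩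
  · induction x using Submodule.Quotient.induction_on with
    | _ v => exact h v
  · rw [← LinearMap.ker_eq_bot, Submodule.ker_liftQ_eq_bot']
    exact h.radical_eq_ker

end SquareRoot

/-! ### The stabilizer field of a subspace -/

section Stabilizer

variable {E Ω : Type*} [Field E] [Field Ω] [Algebra E Ω]

/-- The field of all `x` with `x P ⊆ P`, for a finite-dimensional subspace `P` of a field. -/
def stabilizer (P : Submodule E Ω) [FiniteDimensional E P] : IntermediateField E Ω where
  carrier := {x | ∀ y ∈ P, x * y ∈ P}
  mul_mem' {a b} ha hb y hy := by
    rw [mul_assoc]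
    exact ha _ (hb _ hy)
  add_mem' {a b} ha hb y hy := by
    rw [add_mul]
    exact P.add_mem (ha _ hy) (hb _ hy)
  algebraMap_mem' c y hy := by
    rw [← Algebra.smul_def]
    exact P.smul_mem c hy
  inv_mem' x hx y hy := by
    rcases eq_or_ne x 0 with rfl | hx0
    · simp
    -- Multiplication by `x ≠ 0` is injective on the finite-dimensional `P`, hence surjective, so
    -- division by `x` also preserves `P`.
    let f : P →ₗ[E] P := (LinearMap.mulLeft E x).restrict hx
    have hf : Function.Injective f := fun a b hab => by
      have : x * (a : Ω) = x * b := congrArg Subtype.val hab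
      exact Subtype.ext (mul_left_cancel₀ hx0 this)
    obtain ⟨z, hz⟩ := LinearMap.injective_iff_surjective.1 hf ⟨y, hy⟩
    have hz' : x * (z : Ω) = y := congrArg Subtype.val hz
    rw [← hz', inv_mul_cancel_left₀ hx0]
    exact z.2

variable (P : Submodule E Ω) [FiniteDimensional E P]

theorem mem_stabilizer {x : Ω} : x ∈ stabilizer P ↔ ∀ y ∈ P, x * y ∈ P := Iff.rfl

/-- `P` as a vector space over its stabilizer. -/
def overStabilizer : Submodule (stabilizer P) Ω where
  carrier := P
  add_mem' := P.add_mem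
  zero_mem' := P.zero_mem
  smul_mem' c _ hy := c.2 _ hy

variable {P}

/-- For a fixed nonzero `y` in `P`, the map `x ↦ x y` embeds the stabilizer into `P`. -/
theorem finiteDimensional_stabilizer (hP : P ≠ ⊥) : FiniteDimensional E (stabilizer P) := by
  obtain ⟨y, hy, hy0⟩ := P.ne_bot_iff.1 hP
  let f : stabilizer P →ₗ[E] P :=
    ((LinearMap.mulRight E y).comp (stabilizer P).val.toLinearMap).codRestrict P
      fun x => x.2 y hy
  refine FiniteDimensional.of_injective f fun a b hab => ?_
  have : (a : Ω) * y = b * y := congrArg Subtype.val hab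
  exact Subtype.ext (mul_right_cancel₀ hy0 this)

/-- The tower law; it is the source of the divisibility of `dim p₁` by `2 ^ 𝔡₁(p)`. -/
theorem finrank_stabilizer_mul_finrank :
    Module.finrank E (stabilizer P) * Module.finrank (stabilizer P) (overStabilizer P) =
      Module.finrank E P :=
  Module.finrank_mul_finrank E (stabilizer P) (overStabilizer P)

/-- Write `x ^ 2 = (x y) ^ 2 / y ^ 2` with `y` and `x y` in `P`. -/
theorem sq_mem_of_mem_stabilizer (hP : P ≠ ⊥) (hsq : ∀ y ∈ P, ∃ c, algebraMap E Ω c = y ^ 2)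
    {x : Ω} (hx : x ∈ stabilizer P) : ∃ c, algebraMap E Ω c = x ^ 2 := by
  obtain ⟨y, hy, hy0⟩ := P.ne_bot_iff.1 hP
  obtain ⟨c, hc⟩ := hsq y hy
  obtain ⟨d, hd⟩ := hsq _ (hx y hy)
  refine ⟨d / c, ?_⟩
  rw [map_div₀, hc, hd]
  field_simp

theorem finrank_stabilizer_congr {Q : Submodule E Ω}
    [FiniteDimensional E Q] (h : P = Q) :
    Module.finrank E (stabilizer P) = Module.finrank E (stabilizer Q) := by
  subst h
  rfl

end Stabilizer

/-! ### Product bases of multiquadratic extensions -/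

section Multiquadratic

variable {E Ω : Type*} [Field E] [Field Ω] [Algebra E Ω]

/-- The span over `E` of all products of distinct elements of `B`. -/
def prodSpan (E : Type*) {Ω : Type*} [Field E] [Field Ω] [Algebra E Ω] (B : Finset Ω) :
    Submodule E Ω :=
  Submodule.span E {z | ∃ I ⊆ B, z = ∏ x ∈ I, x}

/-- The products of distinct elements of `B` are linearly independent over `E`. -/
def ProdIndependent (E : Type*) {Ω : Type*} [Field E] [Field Ω] [Algebra E Ω] (B : Finset Ω) :
    Prop :=
  ∀ c : Finset Ω → E, ∑ I ∈ B.powerset, c I • ∏ x ∈ I, x = 0 → ∀ I ∈ B.powerset, c I = 0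

/-- Common factors occur twice. When squares are scalars, subset products therefore multiply by
symmetric difference, both for elements of a field and for the coefficients of a Pfister form. -/
theorem prod_mul_prod_symmDiff {ι R : Type*} [DecidableEq ι] [CommRing R] (f : ι → R)
    (I J : Finset ι) :
    (∏ i ∈ I, f i) * ∏ i ∈ J, f i = (∏ i ∈ I ∩ J, f i) ^ 2 * ∏ i ∈ symmDiff I J, f i := by
  have h1 : (symmDiff I J) = (I ∪ J) \ (I ∩ J) := symmDiff_eq_sup_sdiff_inf I J
  have h2 := Finset.prod_sdiff (f := f) (Finset.inter_subset_union (s := I) (t := J))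
  rw [← Finset.prod_union_inter, h1, ← h2]
  ring

theorem prodSpan_mul_mem {B : Finset Ω} (hB : ∀ x ∈ B, ∃ c, algebraMap E Ω c = x ^ 2) {y z : Ω}
    (hy : y ∈ prodSpan E B) (hz : z ∈ prodSpan E B) : y * z ∈ prodSpan E B := by
  classical
  have := Submodule.mul_mem_mul hy hz
  rw [prodSpan, Submodule.span_mul_span] at this
  refine Submodule.span_le.2 ?_ this
  rintro _ ⟨_, ⟨I, hI, rfl⟩, _, ⟨J, hJ, rfl⟩, rfl⟩
  have hsq : ∃ c, algebraMap E Ω c = (∏ x ∈ I ∩ J, x) ^ 2 := by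
    rw [← Finset.prod_pow]
    have : ∀ x : Ω, ∃ c, x ∈ B → algebraMap E Ω c = x ^ 2 := fun x => by
      by_cases hx : x ∈ B
      · obtain ⟨c, hc⟩ := hB x hx
        exact ⟨c, fun _ => hc⟩
      · exact ⟨0, fun h => absurd h hx⟩
    choose c hc using this
    refine ⟨∏ x ∈ I ∩ J, c x, ?_⟩
    rw [map_prod]
    exact Finset.prod_congr rfl fun x hx => hc x (hI (Finset.mem_inter.1 hx).1)
  obtain ⟨c, hc⟩ := hsq
  change (∏ x ∈ I, x) * ∏ x ∈ J, x ∈ _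
  rw [prod_mul_prod_symmDiff, ← hc, ← Algebra.smul_def]
  refine Submodule.smul_mem _ _ (Submodule.subset_span ⟨_, ?_, rfl⟩)
  exact symmDiff_le_sup.trans (Finset.union_subset hI hJ)

theorem sum_mem_prodSpan (B : Finset Ω) (c : Finset Ω → E) :
    ∑ I ∈ B.powerset, c I • ∏ x ∈ I, x ∈ prodSpan E B :=
  Submodule.sum_mem _ fun I hI => Submodule.smul_mem _ _
    (Submodule.subset_span ⟨I, Finset.mem_powerset.1 hI, rfl⟩)

/-- A relation among the enlarged products reads `w + x z = 0` with `w`, `z` in the old span. If `z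
≠ 0`, then `z ^ 2` is a nonzero scalar and `x = -w z / z ^ 2` lies in that span, which is closed
under multiplication. -/
theorem ProdIndependent.insert_of_notMem [DecidableEq Ω] {N : IntermediateField E Ω}
    (hN : ∀ x ∈ N, ∃ c, algebraMap E Ω c = x ^ 2) {B : Finset Ω} (hBN : ∀ x ∈ B, x ∈ N)
    (hB : ProdIndependent E B) {x : Ω} (hx : x ∉ prodSpan E B) :
    ProdIndependent E (insert x B) := by
  have hBsq : ∀ x ∈ B, ∃ c, algebraMap E Ω c = x ^ 2 := fun y hy => hN y (hBN y hy)
  have hxB : x ∉ B := fun h => hx (Submodule.subset_span ⟨{x}, by simpa using h, by simp⟩)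
  intro c hc
  rw [Finset.sum_powerset_insert hxB] at hc
  have e : ∑ I ∈ B.powerset, c (insert x I) • ∏ y ∈ insert x I, y =
      x * ∑ I ∈ B.powerset, c (insert x I) • ∏ y ∈ I, y := by
    rw [Finset.mul_sum]
    refine Finset.sum_congr rfl fun I hI => ?_
    rw [Finset.prod_insert fun h => hxB (Finset.mem_powerset.1 hI h), mul_smul_comm]
  rw [e] at hc
  set z := ∑ I ∈ B.powerset, c (insert x I) • ∏ y ∈ I, y with hz
  set w := ∑ I ∈ B.powerset, c I • ∏ y ∈ I, y with hw
  have hzS : z ∈ prodSpan E B := sum_mem_prodSpan B fun I => c (insert x I)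
  have hwS : w ∈ prodSpan E B := sum_mem_prodSpan B c
  have hSN : prodSpan E B ≤ N.toSubalgebra.toSubmodule := by
    refine Submodule.span_le.2 ?_
    rintro _ ⟨I, hI, rfl⟩
    exact (prod_mem fun y hy => hBN y (hI hy) : ∏ y ∈ I, y ∈ N)
  have hz0 : z = 0 := by
    by_contra hz0
    obtain ⟨d, hd⟩ := hN z (hSN hzS)
    apply hx
    have : x = (-d⁻¹) • (w * z) := by
      rw [Algebra.smul_def, map_neg, map_inv₀, hd]
      field_simp
      linear_combination hc
    rw [this]
    exact Submodule.smul_mem _ _ (prodSpan_mul_mem hBsq hwS hzS)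
  rw [hz0, mul_zero, add_zero] at hc
  have h1 := hB c hc
  have h2 := hB (fun I => c (insert x I)) hz0
  intro I hI
  rw [Finset.mem_powerset] at hI
  by_cases hxI : x ∈ I
  · rw [← Finset.insert_erase hxI]
    exact h2 _ (Finset.mem_powerset.2 (by rwa [← Finset.subset_insert_iff]))
  · exact h1 _ (Finset.mem_powerset.2 ((Finset.subset_insert_iff_of_notMem hxI).1 hI))

theorem exists_prod_of_prodIndependent {B : Finset Ω} (hB : ProdIndependent E B) :
    ∃ α : Fin B.card → Ω, (∀ i, α i ∈ B) ∧
      (∀ c : Finset (Fin B.card) → E, ∑ I, c I • ∏ i ∈ I, α i = 0 → c = 0) ∧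
      prodSpan E B = Submodule.span E (Set.range fun I : Finset (Fin B.card) => ∏ i ∈ I, α i) := by
  classical
  let e : Fin B.card ≃ B := B.equivFin.symm
  let α : Fin B.card ↪ Ω := e.toEmbedding.trans (Function.Embedding.subtype _)
  have hα : B = Finset.univ.map α := by
    ext x
    simp only [Finset.mem_map, Finset.mem_univ, true_and]
    exact ⟨fun hx => ⟨e.symm ⟨x, hx⟩, by simp [α]⟩, by rintro ⟨i, rfl⟩; exact (e i).2⟩
  have hpow : B.powerset = Finset.univ.map (Finset.mapEmbedding α).toEmbedding := by
    ext J
    simp only [Finset.mem_powerset, Finset.mem_map, Finset.mem_univ, true_and,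
      RelEmbedding.coe_toEmbedding, Finset.mapEmbedding_apply]
    nth_rewrite 1 [hα]
    rw [Finset.subset_map_iff]
    exact ⟨fun ⟨u, _, hu⟩ => ⟨u, hu.symm⟩, fun ⟨u, hu⟩ => ⟨u, Finset.subset_univ _, hu.symm⟩⟩
  refine ⟨α, fun i => (e i).2, fun c hc => ?_, ?_⟩
  · let c' : Finset Ω → E := fun J => c (J.preimage α α.injective.injOn)
    have hpre : ∀ I, c' (I.map α) = c I := fun I => by simp [c', Finset.preimage_map]
    have h := hB c' (by
      rw [hpow, Finset.sum_map, ← hc]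
      exact Finset.sum_congr rfl fun I _ => by simp [hpre])
    funext I
    rw [← hpre]
    exact h _ (by rw [hpow]; exact Finset.mem_map_of_mem _ (Finset.mem_univ I))
  · rw [prodSpan]
    congr 1
    ext z
    simp only [Set.mem_ofPred_eq, Set.mem_range, ← Finset.mem_powerset, hpow, Finset.mem_map,
      Finset.mem_univ, true_and]
    constructor
    · rintro ⟨_, ⟨I, rfl⟩, rfl⟩
      exact ⟨I, by simp⟩
    · rintro ⟨I, rfl⟩
      exact ⟨_, ⟨I, rfl⟩, by simp⟩

/-- A finite extension all of whose elements are square roots of elements of `E` has a basis which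
consists of the products of subsets of some finite set. -/
theorem exists_multiquadratic_basis (N : IntermediateField E Ω) [FiniteDimensional E N]
    (hN : ∀ x ∈ N, ∃ c, algebraMap E Ω c = x ^ 2) :
    ∃ (s : ℕ) (α : Fin s → Ω), (∀ i, α i ∈ N) ∧
      (∀ c : Finset (Fin s) → E, ∑ I, c I • ∏ i ∈ I, α i = 0 → c = 0) ∧
      N.toSubalgebra.toSubmodule =
        Submodule.span E (Set.range fun I : Finset (Fin s) => ∏ i ∈ I, α i) := by
  classical
  have step : ∀ k : ℕ, ∃ B : Finset Ω, (∀ x ∈ B, x ∈ N) ∧ ProdIndependent E B ∧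
      (B.card = k ∨ ∀ x ∈ N, x ∈ prodSpan E B) := by
    intro k
    induction k with
    | zero =>
      refine ⟨∅, by simp, fun c hc => ?_, Or.inl rfl⟩
      simpa using hc
    | succ k ih =>
      obtain ⟨B, hBN, hB, h⟩ := ih
      rcases h with h | h
      · by_cases hx : ∀ x ∈ N, x ∈ prodSpan E B
        · exact ⟨B, hBN, hB, Or.inr hx⟩
        · push Not at hx
          obtain ⟨x, hxN, hx⟩ := hx
          refine ⟨insert x B, ?_, hB.insert_of_notMem hN hBN hx, Or.inl ?_⟩
          · intro y hy
            rcases Finset.mem_insert.1 hy with rfl | hy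
            exacts [hxN, hBN y hy]
          · rw [Finset.card_insert_of_notMem, h]
            exact fun h => hx (Submodule.subset_span ⟨{x}, by simpa using h, by simp⟩)
      · exact ⟨B, hBN, hB, Or.inr h⟩
  -- The choice `k = [N : E]` forces the greedy construction to stop earlier: `k` elements would
  -- give `2 ^ k > k` independent products in `N`.
  obtain ⟨B, hBN, hB, h⟩ := step (Module.finrank E N)
  obtain ⟨α, hα, hind, hspan⟩ := exists_prod_of_prodIndependent hB
  refine ⟨B.card, α, fun i => hBN _ (hα i), hind, ?_⟩
  rw [← hspan]
  refine le_antisymm ?_ ?_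
  · rcases h with h | h
    · exfalso
      let v : Finset (Fin B.card) → N := fun I => ∏ i ∈ I, ⟨α i, hBN _ (hα i)⟩
      have hv : LinearIndependent E v := by
        rw [Fintype.linearIndependent_iff]
        intro c hc I
        have := hind c (by simpa [v] using congrArg (algebraMap N Ω) hc)
        rw [this, Pi.zero_apply]
      have := hv.fintype_card_le_finrank
      rw [Fintype.card_finset, Fintype.card_fin, ← h] at this
      exact absurd this (Nat.lt_two_pow_self).not_ge
    · exact fun x hx => h x hx
  · refine Submodule.span_le.2 ?_
    rintro _ ⟨I, hI, rfl⟩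
    exact (prod_mem fun y hy => hBN y (hI hy) : ∏ y ∈ I, y ∈ N)

end Multiquadratic

/-! ### The divisibility index as the degree of the stabilizer -/

section Divisibility

variable {E Ω X : Type*} [Field E]

theorem pfister_single {s : ℕ} (a : Fin s → Eˣ) (I : Finset (Fin s)) :
    pfister a (Pi.single I 1) = ∏ i ∈ I, (-(a i : E)) := by
  classical
  simp [pfister, QuadraticMap.weightedSumSquares_apply, Pi.single_apply]

variable [CharP E 2] [Field Ω] [Algebra E Ω] [AddCommGroup X] [Module E X]
  [FiniteDimensional E X] {φ : QuadraticForm E X} {ρ : X →ₗ[E] Ω}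

theorem isQuasilinear_weightedSumSquares {ι : Type*} [Fintype ι] (w : ι → E) :
    IsQuasilinear (QuadraticMap.weightedSumSquares E w) := by
  intro x y
  simp only [QuadraticMap.weightedSumSquares_apply, ← Finset.sum_add_distrib]
  refine Finset.sum_congr rfl fun i _ => ?_
  simp only [Pi.add_apply, smul_eq_mul]
  linear_combination (w i * x i * y i) * CharTwo.two_eq_zero (R := E)

/-- The dimension of a Pfister form dividing `φ` is at most the degree of the stabilizer. -/
theorem IsSquareRoot.two_pow_le_finrank_stabilizer [Nontrivial X] (h : IsSquareRoot φ ρ)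
    (hinj : Function.Injective ρ) {s : ℕ} {a : Fin s → Eˣ} (hd : IsDivisibleBy φ (pfister a)) :
    2 ^ s ≤ Module.finrank E (stabilizer (LinearMap.range ρ)) := by
  classical
  have hΩ : CharP Ω 2 := charP_of_injective_algebraMap (algebraMap E Ω).injective 2
  obtain ⟨m, ψ, hψ, ⟨e⟩⟩ := hd
  have hP : LinearMap.range ρ ≠ ⊥ := by
    obtain ⟨x, hx⟩ := exists_ne (0 : X)
    exact (Submodule.ne_bot_iff _).2 ⟨ρ x, ⟨x, rfl⟩, fun h0 => hx (hinj (by rw [h0, map_zero]))⟩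
  have := finiteDimensional_stabilizer hP
  have hm : ∃ w : Fin m → E, w ≠ 0 := by
    by_contra! hw
    obtain ⟨x, hx⟩ := exists_ne (0 : X)
    apply hx
    apply e.toLinearEquiv.injective
    rw [map_zero]
    generalize e.toLinearEquiv x = t
    induction t using TensorProduct.induction_on with
    | zero => rfl
    | tmul v w => rw [hw w, TensorProduct.tmul_zero]
    | add t u ht hu => rw [ht, hu, add_zero]
  obtain ⟨w₀, hw₀⟩ := hm
  let g : (Finset (Fin s) → E) ⊗[E] (Fin m → E) →ₗ[E] Ω := ρ.comp e.symm.toLinearEquiv.toLinearMap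
  have hg : Function.Injective g := hinj.comp e.symm.toLinearEquiv.injective
  have hgsq : ∀ t, g t ^ 2 = algebraMap E Ω (tensor (pfister a) ψ t) := fun t => by
    rw [← e.symm.map_app]
    exact h _
  have hrange : LinearMap.range g = LinearMap.range ρ :=
    LinearMap.range_comp_of_range_eq_top _ (LinearEquiv.range _)
  obtain ⟨f, hf⟩ : ∃ f : Module.Dual E (Fin m → E), f w₀ ≠ 0 := by
    by_contra! hf
    exact hw₀ ((Module.forall_dual_apply_eq_zero_iff E w₀).1 hf)
  have htmul : ∀ v : Finset (Fin s) → E, v ⊗ₜ[E] w₀ = 0 → v = 0 := by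
    intro v hv
    have := congrArg (fun t => TensorProduct.rid E _ (LinearMap.lTensor _ f t)) hv
    simpa [hf] using this
  -- The quotients `y I w₀ / y ∅ w₀` are square roots of the Pfister coefficients `∏ i ∈ I, (-a i)`.
  -- They stabilize the range of `ρ` and are independent, which gives `2 ^ s` independent elements
  -- of the stabilizer.
  let y : Finset (Fin s) → (Fin m → E) → Ω := fun I w => g (Pi.single I 1 ⊗ₜ w)
  have hysq : ∀ I w, y I w ^ 2 = algebraMap E Ω ((∏ i ∈ I, (-(a i : E))) * ψ w) := fun I w => by
    rw [hgsq, tensor_tmul, pfister_single]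
  have hy0 : y ∅ w₀ ≠ 0 := by
    intro h0
    have := htmul _ (hg (h0.trans (map_zero g).symm))
    simpa using congrFun this ∅
  have hmul : ∀ I J w, y I w₀ * y J w =
      y ∅ w₀ * (algebraMap E Ω (∏ i ∈ I ∩ J, (-(a i : E))) * y (symmDiff I J) w) := by
    intro I J w
    -- Squaring is injective in characteristic 2, so it suffices to compare values of the forms.
    rw [← CharTwo.sq_inj]
    simp only [mul_pow, hysq, ← map_mul, ← map_pow]
    congr 1
    have := prod_mul_prod_symmDiff (fun i => (-(a i : E))) I J
    rw [Finset.prod_empty]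
    linear_combination ψ w₀ * ψ w * this
  have hstab : ∀ I, y I w₀ * (y ∅ w₀)⁻¹ ∈ stabilizer (LinearMap.range ρ) := by
    intro I
    rw [mem_stabilizer, ← hrange]
    rintro _ ⟨t, rfl⟩
    induction t using TensorProduct.induction_on with
    | zero => simp
    | add t u ht hu => rw [map_add, mul_add]; exact Submodule.add_mem _ ht hu
    | tmul v w =>
      have hv : v ⊗ₜ[E] w = ∑ J, v J • ((Pi.single J 1 : Finset (Fin s) → E) ⊗ₜ[E] w) := by
        conv_lhs => rw [← Finset.univ_sum_single v]
        rw [TensorProduct.sum_tmul]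
        refine Finset.sum_congr rfl fun J _ => ?_
        rw [TensorProduct.smul_tmul', ← Pi.single_smul, smul_eq_mul, mul_one]
      rw [hv, map_sum, Finset.mul_sum]
      refine Submodule.sum_mem _ fun J _ => ?_
      rw [map_smul, mul_smul_comm]
      refine Submodule.smul_mem _ _ ?_
      have : y I w₀ * (y ∅ w₀)⁻¹ * y J w =
          (∏ i ∈ I ∩ J, (-(a i : E))) • y (symmDiff I J) w := by
        rw [Algebra.smul_def, mul_right_comm, hmul]
        field_simp
      change y I w₀ * (y ∅ w₀)⁻¹ * y J w ∈ _
      rw [this]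
      exact Submodule.smul_mem _ _ ⟨_, rfl⟩
  let v : Finset (Fin s) → stabilizer (LinearMap.range ρ) := fun I => ⟨_, hstab I⟩
  have hv : LinearIndependent E v := by
    rw [Fintype.linearIndependent_iff]
    intro c hc I
    have h1 : ∑ I, c I • (y I w₀ * (y ∅ w₀)⁻¹) = 0 := by
      simpa [v] using congrArg (algebraMap (stabilizer (LinearMap.range ρ)) Ω) hc
    have h2 : g (c ⊗ₜ[E] w₀) * (y ∅ w₀)⁻¹ = 0 := by
      rw [← h1]
      conv_lhs => rw [← Finset.univ_sum_single c]
      rw [TensorProduct.sum_tmul, map_sum, Finset.sum_mul]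
      refine Finset.sum_congr rfl fun J _ => ?_
      have : (Pi.single J (c J) : Finset (Fin s) → E) = c J • Pi.single J 1 := by
        rw [← Pi.single_smul, smul_eq_mul, mul_one]
      rw [this, ← TensorProduct.smul_tmul', map_smul, smul_mul_assoc]
    have h3 : g (c ⊗ₜ[E] w₀) = 0 := (mul_eq_zero.1 h2).resolve_right (inv_ne_zero hy0)
    rw [htmul c (hg (h3.trans (map_zero g).symm)), Pi.zero_apply]
  have := hv.fintype_card_le_finrank
  rwa [Fintype.card_finset, Fintype.card_fin] at this

/-- `φ` is divisible by a Pfister form whose dimension is the degree of the stabilizer. -/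
theorem IsSquareRoot.exists_isDivisibleBy [Nontrivial X] (h : IsSquareRoot φ ρ)
    (hinj : Function.Injective ρ) : ∃ (s : ℕ) (a : Fin s → Eˣ), IsDivisibleBy φ (pfister a) ∧
      2 ^ s = Module.finrank E (stabilizer (LinearMap.range ρ)) := by
  classical
  have hΩ : CharP Ω 2 := charP_of_injective_algebraMap (algebraMap E Ω).injective 2
  have hP : LinearMap.range ρ ≠ ⊥ := by
    obtain ⟨x, hx⟩ := exists_ne (0 : X)
    exact (Submodule.ne_bot_iff _).2 ⟨ρ x, ⟨x, rfl⟩, fun h0 => hx (hinj (by rw [h0, map_zero]))⟩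
  have hsq : ∀ y ∈ LinearMap.range ρ, ∃ c, algebraMap E Ω c = y ^ 2 := by
    rintro _ ⟨x, rfl⟩
    exact ⟨_, (h x).symm⟩
  have hNfin := finiteDimensional_stabilizer hP
  have hNsq : ∀ x ∈ stabilizer (LinearMap.range ρ), ∃ c, algebraMap E Ω c = x ^ 2 :=
    fun x hx => sq_mem_of_mem_stabilizer hP hsq hx
  obtain ⟨s, α, hαN, hind, hspan⟩ := exists_multiquadratic_basis _ hNsq
  have hα0 : ∀ i, α i ≠ 0 := by
    intro i hi
    have := hind (Pi.single {i} 1) (by simp [Pi.single_apply, hi])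
    simpa using congrFun this {i}
  choose c hc using fun i => hNsq _ (hαN i)
  have hc0 : ∀ i, c i ≠ 0 := fun i h0 => by
    have := hc i
    rw [h0, map_zero, eq_comm, pow_eq_zero_iff two_ne_zero] at this
    exact hα0 i this
  -- The slots are `a i = α i ^ 2`; the signs in `pfister` disappear in characteristic 2, so `Θ`
  -- below is a square root of `pfister a` whose range is the stabilizer.
  let a : Fin s → Eˣ := fun i => Units.mk0 (c i) (hc0 i)
  let Θ : (Finset (Fin s) → E) →ₗ[E] Ω :=
    Fintype.linearCombination E fun I : Finset (Fin s) => ∏ i ∈ I, α i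
  have hΘ : ∀ v, Θ v ^ 2 = algebraMap E Ω (pfister a v) := by
    intro v
    simp only [Θ, Fintype.linearCombination_apply, CharTwo.sum_sq, pfister,
      QuadraticMap.weightedSumSquares_apply, map_sum]
    refine Finset.sum_congr rfl fun I _ => ?_
    rw [Algebra.smul_def]
    simp only [smul_eq_mul, map_mul, map_prod, CharTwo.neg_eq, a, Units.val_mk0, hc,
      Finset.prod_pow]
    ring
  have hΘrange : LinearMap.range Θ =
      (stabilizer (LinearMap.range ρ)).toSubalgebra.toSubmodule := by
    rw [hspan, Fintype.range_linearCombination]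
  have hΘinj : Function.Injective Θ := by
    rw [injective_iff_map_eq_zero]
    intro v hv
    exact hind v (by simpa [Θ, Fintype.linearCombination_apply] using hv)
  have hcard : 2 ^ s = Module.finrank E (stabilizer (LinearMap.range ρ)) := by
    have h1 := LinearMap.finrank_range_of_inj hΘinj
    rw [Module.finrank_fintype_fun_eq_card, Fintype.card_finset, Fintype.card_fin, hΘrange] at h1
    exact h1.symm
  refine ⟨s, a, ?_, hcard⟩
  have : FiniteDimensional (stabilizer (LinearMap.range ρ))
      (overStabilizer (LinearMap.range ρ)) := by
    have : FiniteDimensional E (overStabilizer (LinearMap.range ρ)) :=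
      inferInstanceAs (FiniteDimensional E (LinearMap.range ρ))
    exact FiniteDimensional.right E _ _
  have : Module.Free (stabilizer (LinearMap.range ρ)) (overStabilizer (LinearMap.range ρ)) :=
    Module.Free.of_divisionRing _ _
  -- The complementary factor is the diagonal form with entries `b k ^ 2`, for a basis `b` of the
  -- range over the stabilizer.
  let b := Module.finBasis (stabilizer (LinearMap.range ρ)) (overStabilizer (LinearMap.range ρ))
  set m := Module.finrank (stabilizer (LinearMap.range ρ)) (overStabilizer (LinearMap.range ρ))
    with hm
  choose d hd using fun k => hsq _ (b k).2
  let ψ : QuadraticForm E (Fin m → E) := QuadraticMap.weightedSumSquares E d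
  let Λ : (Fin m → E) →ₗ[E] Ω := Fintype.linearCombination E fun k => (b k : Ω)
  have hΛ : ∀ w, Λ w ^ 2 = algebraMap E Ω (ψ w) := by
    intro w
    simp only [Λ, Fintype.linearCombination_apply, CharTwo.sum_sq, ψ,
      QuadraticMap.weightedSumSquares_apply, map_sum]
    refine Finset.sum_congr rfl fun k _ => ?_
    rw [Algebra.smul_def]
    simp only [smul_eq_mul, map_mul, hd]
    ring
  -- Multiplication in `Ω` is a square root of the tensor product. It maps onto the range of `ρ`
  -- because `b` spans over the stabilizer, and it is injective by the tower law.
  let μ : (Finset (Fin s) → E) ⊗[E] (Fin m → E) →ₗ[E] Ω :=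
    TensorProduct.lift ((LinearMap.mul E Ω).compl₁₂ Θ Λ)
  have hμt : ∀ v w, μ (v ⊗ₜ w) = Θ v * Λ w := fun v w => by simp [μ]
  have hπ : IsQuasilinear (pfister a) := isQuasilinear_weightedSumSquares _
  have hψ : IsQuasilinear ψ := isQuasilinear_weightedSumSquares d
  have hμ : ∀ t, μ t ^ 2 = algebraMap E Ω (tensor (pfister a) ψ t) := by
    intro t
    induction t using TensorProduct.induction_on with
    | zero => simp
    | tmul v w => rw [hμt, tensor_tmul, mul_pow, hΘ, hΛ, map_mul]
    | add t u ht hu =>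
      rw [map_add, CharTwo.add_sq, ht, hu,
        isQuasilinear_tensor hπ hψ, map_add]
  have hμP : ∀ t, μ t ∈ LinearMap.range ρ := by
    intro t
    induction t using TensorProduct.induction_on with
    | zero => simp
    | add t u ht hu => rw [map_add]; exact Submodule.add_mem _ ht hu
    | tmul v w =>
      rw [hμt]
      have hv : Θ v ∈ stabilizer (LinearMap.range ρ) := by
        have : Θ v ∈ LinearMap.range Θ := ⟨v, rfl⟩
        rw [hΘrange] at this
        exact this
      refine hv _ ?_
      simp only [Λ, Fintype.linearCombination_apply]
      exact Submodule.sum_mem _ fun k _ => Submodule.smul_mem _ _ (b k).2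
  let μ' := μ.codRestrict (LinearMap.range ρ) hμP
  have hsurj : Function.Surjective μ' := by
    rintro ⟨z, hz⟩
    have hz' := b.sum_repr ⟨z, hz⟩
    have hN : ∀ x : stabilizer (LinearMap.range ρ), ∃ v, Θ v = x := fun x => by
      have : (x : Ω) ∈ LinearMap.range Θ := by
        rw [hΘrange]
        exact x.2
      exact this
    choose v hv using hN
    refine ⟨∑ k, v (b.repr ⟨z, hz⟩ k) ⊗ₜ Pi.single k 1, Subtype.ext ?_⟩
    have e1 : ∑ k, (b.repr ⟨z, hz⟩ k : Ω) * b k = z := by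
      have := congrArg (overStabilizer (LinearMap.range ρ)).subtype hz'
      rw [map_sum] at this
      exact this
    change μ _ = z
    rw [map_sum]
    conv_rhs => rw [← e1]
    refine Finset.sum_congr rfl fun k _ => ?_
    rw [hμt, hv]
    simp [Λ, Fintype.linearCombination_apply, Pi.single_apply]
  have hbij : Function.Bijective μ' := by
    refine ⟨?_, hsurj⟩
    refine (LinearMap.injective_iff_surjective_of_finrank_eq_finrank ?_).2 hsurj
    rw [Module.finrank_tensorProduct, Module.finrank_fintype_fun_eq_card,
      Module.finrank_fintype_fun_eq_card, Fintype.card_finset, Fintype.card_fin, Fintype.card_fin,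
      hcard, hm, finrank_stabilizer_mul_finrank]
  let e : X ≃ₗ[E] (Finset (Fin s) → E) ⊗[E] (Fin m → E) :=
    (LinearEquiv.ofInjective ρ hinj).trans (LinearEquiv.ofBijective μ' hbij).symm
  have he : ∀ x, μ (e x) = ρ x := fun x =>
    congrArg Subtype.val ((LinearEquiv.ofBijective μ' hbij).apply_symm_apply
      (LinearEquiv.ofInjective ρ hinj x))
  refine ⟨m, ψ, hψ, ⟨⟨e, fun x => ?_⟩⟩⟩
  apply (algebraMap E Ω).injective
  change algebraMap E Ω (tensor (pfister a) ψ (e x)) = _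
  rw [← hμ, he, h]

/-- The two preceding bounds, applied to the anisotropic part, show that the supremum is attained.
The range must be nonzero: a zero form is divisible by every Pfister form. -/
theorem IsSquareRoot.two_pow_divisibilityIndex (h : IsSquareRoot φ ρ)
    (hP : LinearMap.range ρ ≠ ⊥) :
    2 ^ divisibilityIndex φ = Module.finrank E (stabilizer (LinearMap.range ρ)) := by
  obtain ⟨ρ', hρ', hinj, hrange⟩ := h.exists_anisPart
  have : Nontrivial (X ⧸ φ.radical) := by
    by_contra hn
    rw [not_nontrivial_iff_subsingleton] at hn
    apply hP
    rw [← hrange, LinearMap.range_eq_bot]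
    exact LinearMap.ext fun x => by rw [Subsingleton.elim x 0, map_zero, map_zero]
  obtain ⟨s, a, hd, hs⟩ := hρ'.exists_isDivisibleBy hinj
  have hgr : IsGreatest {s : ℕ | ∃ a : Fin s → Eˣ, IsDivisibleBy (anisPart φ) (pfister a)} s := by
    refine ⟨⟨a, hd⟩, ?_⟩
    rintro t ⟨a', ha'⟩
    have := hρ'.two_pow_le_finrank_stabilizer hinj ha'
    rw [← hs] at this
    exact (Nat.pow_le_pow_iff_right one_lt_two).1 this
  rw [divisibilityIndex, hgr.csSup_eq, hs]
  exact finrank_stabilizer_congr hrange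

end Divisibility

/-! ### Growth of products of subspaces -/

section Inequality

variable {E Ω : Type*} [Field E] [Field Ω] [Algebra E Ω]

/-- If `P A ⊆ Q` and `A` is larger than the stabilizer of `P`, then the product `P A` is strictly
larger than `P`. -/
theorem finrank_add_finrank_stabilizer_le (P Q A : Submodule E Ω) [FiniteDimensional E P]
    [FiniteDimensional E Q] [FiniteDimensional E A] (hP : P ≠ ⊥)
    (hPA : ∀ x ∈ P, ∀ a ∈ A, x * a ∈ Q)
    (hA : Module.finrank E (stabilizer P) < Module.finrank E A) :
    Module.finrank E P + Module.finrank E (stabilizer P) ≤ Module.finrank E Q := by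
  have := finiteDimensional_stabilizer hP
  have hA0 : A ≠ ⊥ := by
    rintro rfl
    simp at hA
  obtain ⟨a, ha, ha0⟩ := A.ne_bot_iff.1 hA0
  -- Otherwise `a' ↦ a' / a` would embed `A` into the stabilizer of `P`, against the dimension
  -- hypothesis.
  obtain ⟨a', ha', x, hx, hxa⟩ : ∃ a' ∈ A, ∃ x ∈ P, a' * a⁻¹ * x ∉ P := by
    by_contra! hcon
    let f : A →ₗ[E] stabilizer P :=
      ((LinearMap.mulRight E a⁻¹).comp A.subtype).codRestrict
        (stabilizer P).toSubalgebra.toSubmodule fun a' => fun x hx => hcon a' a'.2 x hx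
    have hf : Function.Injective f := fun u v huv => by
      have : (u : Ω) * a⁻¹ = v * a⁻¹ := congrArg Subtype.val huv
      exact Subtype.ext (mul_right_cancel₀ (inv_ne_zero ha0) this)
    exact (LinearMap.finrank_le_finrank_of_injective hf).not_gt hA
  -- With `N` the stabilizer, the sum `P a + N x a'` lies in `Q` and is direct: from `y a + z x a' =
  -- 0` with `z ≠ 0` it follows that `a' a⁻¹ x = -z⁻¹ y` is in `P`.
  let f : P × stabilizer P →ₗ[E] Ω :=
    ((LinearMap.mulRight E a).comp P.subtype).coprod
      ((LinearMap.mulRight E (x * a')).comp (stabilizer P).val.toLinearMap)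
  have hf : ∀ y : P × stabilizer P, f y = y.1 * a + y.2 * (x * a') := fun y => rfl
  have hfQ : ∀ y, f y ∈ Q := fun y => by
    rw [hf, ← mul_assoc]
    exact Q.add_mem (hPA _ y.1.2 _ ha) (hPA _ (y.2.2 _ hx) _ ha')
  have hinj : Function.Injective (f.codRestrict Q hfQ) := by
    rw [injective_iff_map_eq_zero]
    rintro ⟨y, z⟩ h0
    have h1 : (y : Ω) * a + z * (x * a') = 0 := congrArg Subtype.val h0
    have hz : (z : Ω) = 0 := by
      by_contra hz
      apply hxa
      have : a' * a⁻¹ * x = -((z : Ω)⁻¹ * y) := by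
        field_simp
        linear_combination h1
      rw [this]
      exact P.neg_mem ((stabilizer P).inv_mem z.2 _ y.2)
    rw [hz, zero_mul, add_zero] at h1
    have hy : (y : Ω) = 0 := (mul_eq_zero.1 h1).resolve_right ha0
    exact Prod.ext (Subtype.ext hy) (Subtype.ext hz)
  have := LinearMap.finrank_le_finrank_of_injective hinj
  rwa [Module.finrank_prod] at this

end Inequality

/-! ### Existence and scalar extension of square roots -/

section SquareRootExistence

/-- Square roots are unique in characteristic 2, so pointwise chosen roots are automatically linear.
-/
theorem exists_isSquareRoot {F M W : Type*} [Field F] [CharP F 2] [Field M] [IsAlgClosed M]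
    [Algebra F M] [AddCommGroup W] [Module F W] {q : QuadraticForm F W} (hq : IsQuasilinear q) :
    ∃ s : W →ₗ[F] M, IsSquareRoot q s := by
  have hM : CharP M 2 := charP_of_injective_algebraMap (algebraMap F M).injective 2
  choose s hs using fun w : W => IsAlgClosed.exists_pow_nat_eq (algebraMap F M (q w)) two_pos
  refine ⟨{ toFun := s, map_add' := fun v w => ?_, map_smul' := fun c w => ?_ }, hs⟩
  · rw [← CharTwo.sq_inj, CharTwo.add_sq, hs, hs, hs, hq, map_add]
  · rw [← CharTwo.sq_inj, RingHom.id_apply, Algebra.smul_def, mul_pow, hs, hs,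
      QuadraticMap.map_smul, smul_eq_mul, map_mul, map_mul, sq]

theorem isQuasilinear_baseChange {F E W : Type*} [Field F] [Field E] [Algebra F E]
    [AddCommGroup W] [Module F W] [FiniteDimensional F W] {q : QuadraticForm F W}
    (hq : IsQuasilinear q) : IsQuasilinear (baseChange E q) := by
  have h0 : ∀ v w, QuadraticMap.polar q v w = 0 := fun v w => by
    rw [QuadraticMap.polar, hq v w]
    ring
  have hp : (baseChange E q).polarBilin = 0 := by
    ext v w
    simp [polar_baseChange, h0]
  intro x y
  rw [QuadraticMap.map_add (baseChange E q)]
  have : QuadraticMap.polar (baseChange E q) x y = 0 := by simpa using congr($hp x y)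
  rw [this, add_zero]

theorem IsSquareRoot.liftBaseChange {F Ω W : Type*} (E : Type*) [Field F] [CharP F 2] [Field E]
    [Field Ω] [Algebra F E] [Algebra F Ω] [Algebra E Ω] [IsScalarTower F E Ω] [AddCommGroup W]
    [Module F W] [FiniteDimensional F W] {q : QuadraticForm F W} {s : W →ₗ[F] Ω}
    (hs : IsSquareRoot q s) : IsSquareRoot (baseChange E q) (s.liftBaseChange E) := by
  have hM : CharP Ω 2 := charP_of_injective_algebraMap (algebraMap F Ω).injective 2
  intro x
  induction x using TensorProduct.induction_on with
  | zero => simp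
  | tmul a w =>
    rw [LinearMap.liftBaseChange_tmul, Algebra.smul_def, mul_pow, hs, baseChange_tmul, map_mul,
      map_pow, ← IsScalarTower.algebraMap_apply]
  | add x y hx hy =>
    rw [map_add, CharTwo.add_sq, hx, hy, isQuasilinear_baseChange hs.isQuasilinear, map_add]

theorem IsSquareRoot.map_algebra {F W M : Type*} (Ω : Type*) [Field F] [AddCommGroup W]
    [Module F W] {q : QuadraticForm F W} [Field M] [Field Ω] [Algebra F M]
    [Algebra F Ω] [Algebra M Ω] [IsScalarTower F M Ω] {s : W →ₗ[F] M} (hs : IsSquareRoot q s) :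
    IsSquareRoot q (((Algebra.linearMap M Ω).restrictScalars F).comp s) := fun w => by
  rw [IsScalarTower.algebraMap_apply F M Ω, ← hs, map_pow]
  rfl

end SquareRootExistence

/-! ### Derivations and descent of divisibility -/

section Polynomials

open MvPolynomial

/-- A derivation is the second component of a ring homomorphism to the dual numbers. The
homomorphism `f ↦ f + ε ∂ᵢ f` kills `P` because `∂ᵢ P = 0`, and it extends to fractions because a
dual number with nonzero first component is a unit. -/
theorem exists_derivation_fractionField {σ R L : Type*} [CommRing R] [Field L]
    (P : MvPolynomial σ R) [IsDomain (MvPolynomial σ R ⧸ Ideal.span {P})]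
    [Algebra (MvPolynomial σ R ⧸ Ideal.span {P}) L]
    [IsFractionRing (MvPolynomial σ R ⧸ Ideal.span {P}) L] (i : σ) (hP : pderiv i P = 0) :
    ∃ D : Derivation ℤ L L, ∀ f : MvPolynomial σ R,
      D (algebraMap (MvPolynomial σ R ⧸ Ideal.span {P}) L (Ideal.Quotient.mk _ f)) =
        algebraMap (MvPolynomial σ R ⧸ Ideal.span {P}) L (Ideal.Quotient.mk _ (pderiv i f)) := by
  let κ : MvPolynomial σ R →+* L :=
    (algebraMap (MvPolynomial σ R ⧸ Ideal.span {P}) L).comp (Ideal.Quotient.mk _)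
  have hκP : κ P = 0 := by
    change algebraMap _ L (Ideal.Quotient.mk _ P) = 0
    rw [Ideal.Quotient.eq_zero_iff_mem.2 (Ideal.mem_span_singleton_self P), map_zero]
  let Ψ : MvPolynomial σ R →+* TrivSqZeroExt L L :=
    { toFun := fun f => TrivSqZeroExt.inl (κ f) + TrivSqZeroExt.inr (κ (pderiv i f))
      map_zero' := by simp
      map_one' := by simp
      map_add' := fun f g => by ext <;> simp
      map_mul' := fun f g => by ext <;> simp [mul_comm] }
  have hΨ : ∀ f ∈ Ideal.span {P}, Ψ f = 0 := by
    intro f hf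
    obtain ⟨g, rfl⟩ := Ideal.mem_span_singleton'.1 hf
    rw [map_mul]
    have : Ψ P = 0 := by
      change TrivSqZeroExt.inl (κ P) + TrivSqZeroExt.inr (κ (pderiv i P)) = 0
      rw [hκP, hP]
      simp
    rw [this, mul_zero]
  let Ψ' := Ideal.Quotient.lift _ Ψ hΨ
  have hfst : ∀ c, (Ψ' c).fst = algebraMap _ L c := by
    intro c
    obtain ⟨f, rfl⟩ := Ideal.Quotient.mk_surjective c
    change (TrivSqZeroExt.inl (κ f) + TrivSqZeroExt.inr (κ (pderiv i f))).fst = κ f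
    simp
  let Φ : L →+* TrivSqZeroExt L L := IsLocalization.lift
    (M := nonZeroDivisors (MvPolynomial σ R ⧸ Ideal.span {P})) (g := Ψ') fun c => by
      rw [TrivSqZeroExt.isUnit_iff_isUnit_fst, hfst, isUnit_iff_ne_zero]
      exact IsFractionRing.to_map_ne_zero_of_mem_nonZeroDivisors c.2
  have hΦ : ∀ c, Φ (algebraMap _ L c) = Ψ' c := fun c => IsLocalization.lift_eq _ c
  have hid : ∀ x, (Φ x).fst = x := by
    have : (TrivSqZeroExt.fstHom L L L : TrivSqZeroExt L L →+* L).comp Φ = RingHom.id L :=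
      IsLocalization.ringHom_ext (nonZeroDivisors (MvPolynomial σ R ⧸ Ideal.span {P})) <|
        RingHom.ext fun c => by
          change (Φ (algebraMap _ L c)).fst = algebraMap _ L c
          rw [hΦ, hfst]
    exact fun x => congr($this x)
  refine ⟨Derivation.mk' (AddMonoidHom.toIntLinearMap
    { toFun := fun x => (Φ x).snd, map_zero' := by simp, map_add' := fun x y => by simp })
    fun x y => ?_, fun f => ?_⟩
  · change (Φ (x * y)).snd = x * (Φ y).snd + y * (Φ x).snd
    rw [map_mul, TrivSqZeroExt.snd_mul, hid, hid]
    simp [mul_comm]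
  · change (Φ (algebraMap _ L (Ideal.Quotient.mk _ f))).snd = κ (pderiv i f)
    rw [hΦ]
    change (TrivSqZeroExt.inl (κ f) + TrivSqZeroExt.inr (κ (pderiv i f))).snd = _
    simp

/-- Divisibility of a combination of polynomials over `F` with coefficients in an extension `M`
that are linearly independent over `F` descends to the polynomials. -/
theorem dvd_of_map_dvd_sum {σ F M κ : Type*} [Field F] [Field M] [Algebra F M] [Fintype κ]
    {s : κ → M} (hs : LinearIndependent F s) (P : MvPolynomial σ F) (f : κ → MvPolynomial σ F)
    (h : map (algebraMap F M) P ∣ ∑ k, C (s k) * map (algebraMap F M) (f k)) (k : κ) :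
    P ∣ f k := by
  classical
  have hker : LinearMap.ker (Fintype.linearCombination F s) = ⊥ := by
    rw [LinearMap.ker_eq_bot]
    exact hs.fintypeLinearCombination_injective
  obtain ⟨g, hg⟩ := LinearMap.exists_leftInverse_of_injective _ hker
  -- A functional dual to `s k`. Applied to coefficients it becomes an `F[T]`-linear map `T` which
  -- sends the given combination to `f k` and a multiple of `P` to a multiple of `P`.
  let lam : M →ₗ[F] F := (LinearMap.proj k).comp g
  have hlam : ∀ j, lam (s j) = if k = j then 1 else 0 := by
    intro j
    have := congr($hg (Pi.single j 1))
    simp only [LinearMap.comp_apply, Fintype.linearCombination_apply_single, one_smul,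
      LinearMap.id_apply] at this
    change g (s j) k = _
    rw [this, Pi.single_apply]
  have hcoeff : ∀ (f : MvPolynomial σ M) m,
      coeff m (AddMonoidAlgebra.map lam.toAddMonoidHom f : MvPolynomial σ F) = lam (coeff m f) :=
    fun f m => rfl
  let T : MvPolynomial σ M →+ MvPolynomial σ F :=
    AddMonoidHom.mk' (fun f => AddMonoidAlgebra.map lam.toAddMonoidHom f) fun f g => by
      ext m
      rw [coeff_add, hcoeff, hcoeff, hcoeff, coeff_add, map_add]
  have hT : ∀ f m, coeff m (T f) = lam (coeff m f) := hcoeff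
  have hmul : ∀ (f : MvPolynomial σ F) (g : MvPolynomial σ M),
      T (map (algebraMap F M) f * g) = f * T g := by
    intro f g
    ext m
    rw [hT, coeff_mul, coeff_mul, map_sum]
    refine Finset.sum_congr rfl fun x _ => ?_
    rw [coeff_map, ← Algebra.smul_def, map_smul, hT, smul_eq_mul]
  have hC : ∀ (x : M), T (C x) = C (lam x) := by
    intro x
    ext m
    rw [hT, coeff_C, coeff_C]
    split_ifs <;> simp
  obtain ⟨g, hg⟩ := h
  refine ⟨T g, ?_⟩
  rw [← hmul, ← hg, map_sum]
  have : ∀ j, T (C (s j) * map (algebraMap F M) (f j)) = if k = j then f j else 0 := fun j => by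
    rw [mul_comm, hmul, hC, hlam]
    split_ifs <;> simp
  simp [this]

end Polynomials

universe u

/-! ### The hyperplane `l = 0` over the quadric `l ^ 2 = 0` -/

section LinearFactor

open MvPolynomial

variable {F M Ω σ : Type*} [Field F] [Field M] [Algebra F M] [Field Ω]

theorem prime_sum_C_mul_X [Fintype σ] {r : σ → M} (hr : ∃ i, r i ≠ 0) :
    Prime (∑ i, C (r i) * X i : MvPolynomial σ M) := by
  classical
  have h : (∑ i, C (r i) * X i : MvPolynomial σ M) =
      sumSMulX (Finsupp.equivFunOnFinite.symm r) := by
    rw [sumSMulX, Finsupp.linearCombination_apply, Finsupp.sum_fintype _ _ (by simp)]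
    exact Finset.sum_congr rfl fun i _ => by simp [smul_eq_C_mul]
  obtain ⟨i, hi⟩ := hr
  rw [h]
  refine (irreducible_sumSMulX _ (Finsupp.support_nonempty_iff.2 ?_) fun c hc => ?_).prime
  · intro h0
    exact hi (by simpa using congr($h0 i))
  · refine isUnit_iff_ne_zero.2 fun h0 => hi ?_
    have := hc i
    rw [h0, zero_dvd_iff] at this
    simpa using this

/-- A prime element generates the kernel of a homomorphism to a field. -/
theorem exists_ringHom_field {R : Type u} [CommRing R] {l : R} (hl : Prime l) :
    ∃ (Ω : Type u) (_ : Field Ω) (π : R →+* Ω), ∀ f, π f = 0 ↔ l ∣ f := by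
  have : (Ideal.span {l}).IsPrime := (Ideal.span_singleton_prime hl.ne_zero).2 hl
  refine ⟨FractionRing (R ⧸ Ideal.span {l}), inferInstance,
    (algebraMap (R ⧸ Ideal.span {l}) _).comp (Ideal.Quotient.mk _), fun f => ?_⟩
  rw [RingHom.comp_apply, FaithfulSMul.algebraMap_eq_zero_iff, Ideal.Quotient.eq_zero_iff_mem,
    Ideal.mem_span_singleton]

theorem dvd_of_map_dvd {P f : MvPolynomial σ F}
    (h : map (algebraMap F M) P ∣ map (algebraMap F M) f) : P ∣ f := by
  have hs : LinearIndependent F fun _ : Unit => (1 : M) :=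
    linearIndependent_unique_iff.2 one_ne_zero
  exact dvd_of_map_dvd_sum hs P (fun _ => f) (by simpa using h) ()

variable {L : Type*} [Field L] (P : MvPolynomial σ F)
  [IsDomain (MvPolynomial σ F ⧸ Ideal.span {P})]
  [Algebra (MvPolynomial σ F ⧸ Ideal.span {P}) L]
  [IsFractionRing (MvPolynomial σ F ⧸ Ideal.span {P}) L]
  {l : MvPolynomial σ M} {π : MvPolynomial σ M →+* Ω}

/-- Injectivity on the coordinate ring: if `l ∣ f` over `M`, then `P = l ^ 2` divides `f ^ 2` over
`M`, hence over `F`, and the quotient by `P` is a domain. -/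
theorem exists_fractionField_ringHom (hl : map (algebraMap F M) P = l ^ 2)
    (hπ : ∀ f, π f = 0 ↔ l ∣ f) : ∃ j : L →+* Ω, ∀ f : MvPolynomial σ F,
    j (algebraMap (MvPolynomial σ F ⧸ Ideal.span {P}) L (Ideal.Quotient.mk _ f)) =
      π (map (algebraMap F M) f) := by
  let g : MvPolynomial σ F ⧸ Ideal.span {P} →+* Ω :=
    Ideal.Quotient.lift _ (π.comp (map (algebraMap F M))) fun f hf => by
      obtain ⟨h, rfl⟩ := Ideal.mem_span_singleton.1 hf
      rw [RingHom.comp_apply, map_mul, hl, hπ]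
      exact Dvd.intro_left _ (by ring : (l * map (algebraMap F M) h) * l = _)
  have hg : Function.Injective g := by
    rw [injective_iff_map_eq_zero]
    intro c hc
    obtain ⟨f, rfl⟩ := Ideal.Quotient.mk_surjective c
    have h1 : l ∣ map (algebraMap F M) f := (hπ _).1 hc
    have h2 : P ∣ f ^ 2 := dvd_of_map_dvd (M := M) (by
      rw [hl, map_pow]
      exact pow_dvd_pow_of_dvd h1 2)
    rw [← pow_eq_zero_iff (two_ne_zero : (2 : ℕ) ≠ 0), ← map_pow, Ideal.Quotient.eq_zero_iff_mem]
    exact Ideal.mem_span_singleton.2 h2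
  exact ⟨IsFractionRing.lift hg, fun f => IsFractionRing.lift_algebraMap hg _⟩

/-- With a common denominator `d`, the relation becomes `∑ fₖ sₖ = l g`, and `z` is the class of `g
/ d`. Differentiating this identity and reducing modulo `l` leaves `rᵢ g`, the same `g` for every
`i`. -/
theorem exists_cofactor {κ : Type*} [Fintype κ] (hl : map (algebraMap F M) P = l ^ 2)
    (hπ : ∀ f, π f = 0 ↔ l ∣ f) {r : σ → M} (hr : ∀ i, pderiv i l = C (r i))
    {D : σ → Derivation ℤ L L} (hD : ∀ i f,
      D i (algebraMap (MvPolynomial σ F ⧸ Ideal.span {P}) L (Ideal.Quotient.mk _ f)) =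
        algebraMap (MvPolynomial σ F ⧸ Ideal.span {P}) L (Ideal.Quotient.mk _ (pderiv i f)))
    {j : L →+* Ω} (hj : ∀ f : MvPolynomial σ F,
      j (algebraMap (MvPolynomial σ F ⧸ Ideal.span {P}) L (Ideal.Quotient.mk _ f)) =
        π (map (algebraMap F M) f))
    {s : κ → M} (hs : LinearIndependent F s) (c : κ → L)
    (hc : ∑ k, j (c k) * π (C (s k)) = 0) :
    ∃ z : Ω, (∀ i, ∑ k, j (D i (c k)) * π (C (s k)) = π (C (r i)) * z) ∧ (z = 0 → c = 0) := by
  classical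
  let ι : MvPolynomial σ F → L := fun f =>
    algebraMap (MvPolynomial σ F ⧸ Ideal.span {P}) L (Ideal.Quotient.mk _ f)
  obtain ⟨b, hb⟩ := IsLocalization.exist_integer_multiples_of_finite
    (nonZeroDivisors (MvPolynomial σ F ⧸ Ideal.span {P})) c
  obtain ⟨d, hd⟩ := Ideal.Quotient.mk_surjective (b : MvPolynomial σ F ⧸ Ideal.span {P})
  have hd0 : ι d ≠ 0 := by
    change algebraMap _ L (Ideal.Quotient.mk _ d) ≠ 0
    rw [hd]
    exact IsFractionRing.to_map_ne_zero_of_mem_nonZeroDivisors b.2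
  have hf : ∀ k, ∃ f, ι f = ι d * c k := by
    intro k
    obtain ⟨y, hy⟩ := hb k
    obtain ⟨f, rfl⟩ := Ideal.Quotient.mk_surjective y
    refine ⟨f, hy.trans ?_⟩
    rw [← hd]
    exact Algebra.smul_def _ _
  choose f hf using hf
  have hjd0 : j (ι d) ≠ 0 := (map_ne_zero j).2 hd0
  have hl0 : l ∣ ∑ k, C (s k) * map (algebraMap F M) (f k) := by
    rw [← hπ, map_sum]
    calc _ = ∑ k, j (ι d) * (j (c k) * π (C (s k))) := by
          refine Finset.sum_congr rfl fun k _ => ?_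
          rw [map_mul, ← hj]
          change _ * j (ι (f k)) = _
          rw [hf, map_mul]
          ring
      _ = 0 := by rw [← Finset.mul_sum, hc, mul_zero]
  obtain ⟨g, hg⟩ := hl0
  refine ⟨π g / j (ι d), fun i => ?_, fun hz => ?_⟩
  · have h1 : ∀ k, j (D i (c k)) * π (C (s k)) = (j (ι d))⁻¹ *
        (π (C (s k) * map (algebraMap F M) (pderiv i (f k))) -
          j (D i (ι d)) * (j (c k) * π (C (s k)))) := by
      intro k
      have h2 : ι (pderiv i (f k)) = ι d * D i (c k) + c k * D i (ι d) := by
        have := hD i (f k)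
        change D i (ι (f k)) = ι _ at this
        rw [← this, hf, Derivation.leibniz, smul_eq_mul, smul_eq_mul]
      have h3 : π (map (algebraMap F M) (pderiv i (f k))) =
          j (ι d) * j (D i (c k)) + j (c k) * j (D i (ι d)) := by
        rw [← hj, ← map_mul, ← map_mul, ← map_add, ← h2]
      rw [map_mul, h3]
      field_simp
      ring
    rw [Finset.sum_congr rfl fun k _ => h1 k, ← Finset.mul_sum, Finset.sum_sub_distrib,
      ← Finset.mul_sum, hc, mul_zero, sub_zero, ← map_sum]
    have h4 : ∑ k, C (s k) * map (algebraMap F M) (pderiv i (f k)) =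
        l * pderiv i g + g * C (r i) := by
      have := congrArg (pderiv i) hg
      rw [map_sum, Derivation.leibniz, hr] at this
      rw [← smul_eq_mul, ← smul_eq_mul, ← this]
      refine Finset.sum_congr rfl fun k _ => ?_
      rw [Derivation.leibniz, pderiv_C, smul_zero, add_zero, pderiv_map, smul_eq_mul]
    rw [h4, map_add, map_mul, (hπ l).2 dvd_rfl]
    rw [map_mul]
    field_simp
    ring
  · have hg0 : l ∣ g := by
      rw [← hπ]
      exact (div_eq_zero_iff.1 hz).resolve_right hjd0
    obtain ⟨g', rfl⟩ := hg0
    funext k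
    have h1 : P ∣ f k := dvd_of_map_dvd_sum hs P f (by
      rw [hg, hl]
      exact ⟨g', by ring⟩) k
    have h2 : ι (f k) = 0 := by
      change algebraMap _ L (Ideal.Quotient.mk _ (f k)) = 0
      rw [Ideal.Quotient.eq_zero_iff_mem.2 (Ideal.mem_span_singleton.2 h1), map_zero]
    rw [hf] at h2
    exact (mul_eq_zero.1 h2).resolve_left hd0

end LinearFactor

/-! ### Derivations on the function field of a quasilinear quadric -/

section FunctionField

open MvPolynomial

variable {F V : Type*} [Field F] [AddCommGroup V] [Module F V] [FiniteDimensional F V]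
  {p : QuadraticForm F V}

theorem formPoly_eq (h : IsQuasilinear p) :
    formPoly p = ∑ i, C (p (Module.finBasis F V i)) * X i ^ 2 := by
  refine Finset.sum_congr rfl fun i _ => ?_
  rw [Finset.sum_eq_single i]
  · rw [toBilin_self, sq]
  · intro j _ hji
    rw [QuadraticMap.toBilin_apply, if_neg hji.symm, QuadraticMap.polar, h]
    simp
  · simp

theorem pderiv_formPoly [CharP F 2] (h : IsQuasilinear p) (i : Fin (Module.finrank F V)) :
    pderiv i (formPoly p) = 0 := by
  rw [formPoly_eq h, map_sum]
  refine Finset.sum_eq_zero fun j _ => ?_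
  rw [pderiv_C_mul, pderiv_pow]
  simp [CharTwo.two_eq_zero]

theorem map_formPoly [CharP F 2] (h : IsQuasilinear p) {M : Type*} [Field M] [Algebra F M]
    {r : V →ₗ[F] M} (hr : IsSquareRoot p r) : map (algebraMap F M) (formPoly p) =
      (∑ i, C (r (Module.finBasis F V i)) * X i) ^ 2 := by
  have hM : CharP M 2 := charP_of_injective_algebraMap (algebraMap F M).injective 2
  rw [CharTwo.sum_sq, formPoly_eq h, map_sum]
  refine Finset.sum_congr rfl fun i _ => ?_
  rw [map_mul, map_C, ← hr, mul_pow, map_pow (map _), map_X, map_pow]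

variable (hp : p.Anisotropic) (hd : 2 ≤ Module.finrank F V)

noncomputable instance : Algebra (CoordinateRing p) (AffineFunctionField p hp hd) :=
  inferInstanceAs (Algebra (CoordinateRing p) (FractionRing (CoordinateRing p)))

instance : IsFractionRing (CoordinateRing p) (AffineFunctionField p hp hd) :=
  inferInstanceAs (IsFractionRing (CoordinateRing p) (FractionRing (CoordinateRing p)))

theorem algebraMap_mk_X (i : Fin (Module.finrank F V)) :
    algebraMap (CoordinateRing p) (AffineFunctionField p hp hd) (Ideal.Quotient.mk _ (X i)) =
      coord p hp hd i := rfl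

theorem algebraMap_mk_C (c : F) :
    algebraMap (CoordinateRing p) (AffineFunctionField p hp hd) (Ideal.Quotient.mk _ (C c)) =
      algebraMap F (AffineFunctionField p hp hd) c := rfl

theorem coord_ne_zero (i : Fin (Module.finrank F V)) : coord p hp hd i ≠ 0 := by
  have := isDomain_coordinateRing p hp hd
  rw [← algebraMap_mk_X, Ne, FaithfulSMul.algebraMap_eq_zero_iff, Ideal.Quotient.eq_zero_iff_mem,
    Ideal.mem_span_singleton]
  rintro ⟨g, hg⟩
  have hne := (irreducible_formPoly p hp hd).ne_zero
  have hg0 : g ≠ 0 := by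
    rintro rfl
    exact X_ne_zero i (hg.trans (mul_zero _))
  have := congrArg totalDegree hg
  rw [totalDegree_X, totalDegree_mul_of_isDomain hne hg0,
    (isHomogeneous_formPoly p).totalDegree hne] at this
  omega

/-- Multiplying the derivation `∂/∂Tᵢ` by a coordinate yields a derivation of `F(p)`. -/
theorem coord_mul_derivation_mem {i₀ i : Fin (Module.finrank F V)}
    {D : Derivation ℤ (AffineFunctionField p hp hd) (AffineFunctionField p hp hd)}
    (hD : ∀ f, D (algebraMap (CoordinateRing p) _ (Ideal.Quotient.mk _ f)) =
      algebraMap (CoordinateRing p) _ (Ideal.Quotient.mk _ (pderiv i f)))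
    {x : AffineFunctionField p hp hd} (hx : x ∈ functionField p hp hd) :
    coord p hp hd i₀ * D x ∈ functionField p hp hd := by
  have hratio : ∀ a b, coord p hp hd a / coord p hp hd b ∈ functionField p hp hd :=
    fun a b => IntermediateField.subset_adjoin _ _ ⟨a, b, rfl⟩
  have hDX : ∀ a, D (coord p hp hd a) = 0 ∨ D (coord p hp hd a) = 1 := by
    classical
    intro a
    rw [← algebraMap_mk_X, hD, pderiv_X]
    rcases eq_or_ne i a with rfl | hia
    · right
      simp
    · left
      simp [hia]
  have hDX' : ∀ a, D (coord p hp hd a) ∈ functionField p hp hd := fun a => by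
    rcases hDX a with h | h <;> rw [h]
    exacts [zero_mem _, one_mem _]
  induction hx using IntermediateField.adjoin_induction with
  | mem x hx =>
    obtain ⟨a, b, rfl⟩ := hx
    have hb := coord_ne_zero hp hd b
    -- A partial derivative lowers degrees by one and the coordinate restores degree zero: the
    -- quotient rule expresses the result through ratios of coordinates.
    have : coord p hp hd i₀ * D (coord p hp hd a / coord p hp hd b) =
        coord p hp hd i₀ / coord p hp hd b * D (coord p hp hd a) -
          coord p hp hd a / coord p hp hd b * (coord p hp hd i₀ / coord p hp hd b) *
            D (coord p hp hd b) := by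
      rw [Derivation.leibniz_div, smul_eq_mul, smul_eq_mul, smul_eq_mul]
      field_simp
    rw [this]
    exact sub_mem (mul_mem (hratio _ _) (hDX' _))
      (mul_mem (mul_mem (hratio _ _) (hratio _ _)) (hDX' _))
  | algebraMap c =>
    rw [← algebraMap_mk_C, hD, pderiv_C, map_zero, map_zero, mul_zero]
    exact zero_mem _
  | add x y _ _ ihx ihy =>
    rw [map_add, mul_add]
    exact add_mem ihx ihy
  | inv x hx ih =>
    rw [Derivation.leibniz_inv, smul_eq_mul]
    have : coord p hp hd i₀ * (-x⁻¹ ^ 2 * D x) = -x⁻¹ ^ 2 * (coord p hp hd i₀ * D x) := by ring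
    rw [this]
    exact mul_mem (neg_mem (pow_mem (inv_mem hx) 2)) ih
  | mul x y hx hy ihx ihy =>
    rw [Derivation.leibniz, smul_eq_mul, smul_eq_mul]
    have : coord p hp hd i₀ * (x * D y + y * D x) =
        x * (coord p hp hd i₀ * D y) + y * (coord p hp hd i₀ * D x) := by ring
    rw [this]
    exact add_mem (mul_mem hx ihy) (mul_mem hy ihx)

end FunctionField

/-! ### The embedding of the kernel and the dichotomy -/

section FunctionField

open MvPolynomial

variable {F : Type u} {V W : Type*} [Field F] [CharP F 2] [AddCommGroup V] [Module F V]
  [FiniteDimensional F V] [AddCommGroup W] [Module F W] [FiniteDimensional F W]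
  {p : QuadraticForm F V} {q : QuadraticForm F W}

set_option maxHeartbeats 1000000 in
/-- Over an extension `Ω` of `F(p)` both `p` and `q` acquire square roots `ρ` and `τ`, and the kernel
of `τ` embeds into `Ω` in such a way that its product with the range of `ρ` lies in the range of
`τ`. The embedding is given by differentiating the coordinates of vectors of the kernel. -/
theorem exists_squareRoots_functionField (hp : p.Anisotropic) (hq : q.Anisotropic)
    (hpl : IsQuasilinear p) (hql : IsQuasilinear q) (hd : 2 ≤ Module.finrank F V) :
    ∃ (Ω : Type u) (_ : Field Ω) (_ : Algebra (functionField p hp hd) Ω)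
      (ρ : functionField p hp hd ⊗[F] V →ₗ[functionField p hp hd] Ω)
      (τ : functionField p hp hd ⊗[F] W →ₗ[functionField p hp hd] Ω),
      IsSquareRoot (baseChange (functionField p hp hd) p) ρ ∧
      IsSquareRoot (baseChange (functionField p hp hd) q) τ ∧
      LinearMap.range ρ ≠ ⊥ ∧
      ∃ A : LinearMap.ker τ →ₗ[functionField p hp hd] Ω, Function.Injective A ∧
        ∀ x u, ρ x * A u ∈ LinearMap.range τ := by
  classical
  have := isDomain_coordinateRing p hp hd
  obtain ⟨r, hr⟩ := exists_isSquareRoot (M := AlgebraicClosure F) hpl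
  obtain ⟨s, hs⟩ := exists_isSquareRoot (M := AlgebraicClosure F) hql
  have hsinj : Function.Injective s := by
    rw [injective_iff_map_eq_zero]
    exact fun w hw => hq w ((hs.map_eq_zero_iff w).2 hw)
  let bV := Module.finBasis F V
  let bW := Module.finBasis F W
  have hr0 : ∀ i, r (bV i) ≠ 0 := fun i h0 =>
    bV.ne_zero i (hp _ ((hr.map_eq_zero_iff _).2 h0))
  let i₀ : Fin (Module.finrank F V) := ⟨0, by omega⟩
  obtain ⟨Ω, _, π, hπ⟩ := exists_ringHom_field (prime_sum_C_mul_X (r := fun i => r (bV i)) ⟨i₀, hr0 i₀⟩)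
  have hl := map_formPoly hpl hr
  obtain ⟨j, hj⟩ := exists_fractionField_ringHom (L := AffineFunctionField p hp hd) (formPoly p)
    hl hπ
  choose D hD using fun i => exists_derivation_fractionField (L := AffineFunctionField p hp hd)
    (formPoly p) i (pderiv_formPoly hpl i)
  have hrl : ∀ i, pderiv i (∑ i, C (r (bV i)) * X i : MvPolynomial _ (AlgebraicClosure F)) =
      C (r (bV i)) := by
    intro i
    rw [map_sum, Finset.sum_eq_single i]
    · rw [pderiv_C_mul, pderiv_X_self, mul_one]
    · intro k _ hk
      rw [pderiv_C_mul, pderiv_X_of_ne hk, mul_zero]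
    · simp
  let _ : Algebra (AffineFunctionField p hp hd) Ω := j.toAlgebra
  let _ : Algebra F Ω := (j.comp (algebraMap F (AffineFunctionField p hp hd))).toAlgebra
  have : IsScalarTower F (functionField p hp hd) Ω := IsScalarTower.of_algebraMap_eq fun _ => rfl
  have hjE : ∀ e : functionField p hp hd, algebraMap (functionField p hp hd) Ω e = j e :=
    fun _ => rfl
  have hFΩ : ∀ c : F, algebraMap F Ω c = π (C (algebraMap F (AlgebraicClosure F) c)) := fun c => by
    have := hj (C c)
    rw [algebraMap_mk_C, map_C] at this
    exact this
  let _ : Algebra (AlgebraicClosure F) Ω := (π.comp C).toAlgebra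
  have : IsScalarTower F (AlgebraicClosure F) Ω := IsScalarTower.of_algebraMap_eq hFΩ
  let ρ := (((Algebra.linearMap (AlgebraicClosure F) Ω).restrictScalars F).comp r).liftBaseChange
    (functionField p hp hd)
  let τ := (((Algebra.linearMap (AlgebraicClosure F) Ω).restrictScalars F).comp s).liftBaseChange
    (functionField p hp hd)
  let BV := bV.baseChange (functionField p hp hd)
  let BW := bW.baseChange (functionField p hp hd)
  have hρB : ∀ i, ρ (BV i) = π (C (r (bV i))) := fun i => by
    rw [Module.Basis.baseChange_apply, LinearMap.liftBaseChange_tmul, one_smul]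
    rfl
  have hτB : ∀ k, τ (BW k) = π (C (s (bW k))) := fun k => by
    rw [Module.Basis.baseChange_apply, LinearMap.liftBaseChange_tmul, one_smul]
    rfl
  have hτ : ∀ c : Fin (Module.finrank F W) → functionField p hp hd,
      τ (∑ k, c k • BW k) = ∑ k, j (c k) * π (C (s (bW k))) := fun c => by
    rw [map_sum]
    refine Finset.sum_congr rfl fun k _ => ?_
    rw [map_smul, hτB, Algebra.smul_def, hjE]
  have hr'0 : π (C (r (bV i₀))) ≠ 0 :=
    (map_ne_zero (algebraMap (AlgebraicClosure F) Ω)).2 (hr0 i₀)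
  -- The derivations `D i` live on `F[p]`; the factor `coord i₀` turns them into derivations of
  -- `F(p)`, so that `Δ i u` below has coefficients in `F(p)` and lies in the range of `τ`.
  let δ : Fin (Module.finrank F V) → functionField p hp hd → functionField p hp hd :=
    fun i e => ⟨coord p hp hd i₀ * D i e, coord_mul_derivation_mem hp hd (hD i) e.2⟩
  let Δ : Fin (Module.finrank F V) → functionField p hp hd ⊗[F] W → Ω :=
    fun i u => ∑ k, j (δ i (BW.repr u k)) * π (C (s (bW k)))
  have hΔrange : ∀ i u, Δ i u ∈ LinearMap.range τ := fun i u => ⟨_, hτ _⟩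
  have hΔ : ∀ u ∈ LinearMap.ker τ, ∃ z : Ω, (∀ i, Δ i u = π (C (r (bV i))) * z) ∧
      (z = 0 → u = 0) := by
    intro u hu
    obtain ⟨z, hz, hz0⟩ := exists_cofactor (formPoly p) hl hπ hrl hD hj
      (bW.linearIndependent.map' s (LinearMap.ker_eq_bot.2 hsinj))
      (fun k => (BW.repr u k : AffineFunctionField p hp hd)) (by
        rw [← LinearMap.mem_ker.1 hu]
        conv_rhs => rw [← BW.sum_repr u]
        exact (hτ _).symm)
    refine ⟨j (coord p hp hd i₀) * z, fun i => ?_, fun h0 => ?_⟩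
    · rw [mul_left_comm, ← hz, Finset.mul_sum]
      refine Finset.sum_congr rfl fun k _ => ?_
      rw [← mul_assoc, ← map_mul]
      rfl
    · have h1 := hz0 ((mul_eq_zero.1 h0).resolve_left
        ((map_ne_zero j).2 (coord_ne_zero hp hd i₀)))
      apply BW.repr.injective
      ext k
      simpa using congrFun h1 k
  have hδadd : ∀ i a b, δ i (a + b) = δ i a + δ i b := fun i a b => Subtype.ext (by
    change coord p hp hd i₀ * D i ((a : AffineFunctionField p hp hd) + b) = _ * _ + _ * _
    rw [map_add, mul_add])
  have hδmul : ∀ i a b, δ i (a * b) = a * δ i b + δ i a * b := fun i a b => Subtype.ext (by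
    change coord p hp hd i₀ * D i ((a : AffineFunctionField p hp hd) * b) =
      a * (_ * D i b) + (_ * D i a) * b
    rw [Derivation.leibniz, smul_eq_mul, smul_eq_mul]
    ring)
  have hΔadd : ∀ i u v, Δ i (u + v) = Δ i u + Δ i v := fun i u v => by
    simp only [Δ]
    rw [← Finset.sum_add_distrib]
    refine Finset.sum_congr rfl fun k _ => ?_
    rw [map_add, Finsupp.add_apply, hδadd, IntermediateField.coe_add, map_add, add_mul]
  -- Linearity holds only on `ker τ`: the additional Leibniz term is `δ i e * τ u`.
  have hΔsmul : ∀ i (e : functionField p hp hd), ∀ u ∈ LinearMap.ker τ, Δ i (e • u) = j e * Δ i u := fun i e u hu => by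
    have h0 : ∑ k, j (BW.repr u k) * π (C (s (bW k))) = 0 := by
      rw [← hτ, BW.sum_repr]
      exact hu
    have h1 : Δ i (e • u) = j e * Δ i u +
        j (δ i e) * ∑ k, j (BW.repr u k) * π (C (s (bW k))) := by
      simp only [Δ]
      rw [Finset.mul_sum, Finset.mul_sum, ← Finset.sum_add_distrib]
      refine Finset.sum_congr rfl fun k _ => ?_
      rw [map_smul, Finsupp.smul_apply, smul_eq_mul, hδmul, IntermediateField.coe_add,
        IntermediateField.coe_mul, IntermediateField.coe_mul, map_add, map_mul j (e : AffineFunctionField p hp hd),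
        map_mul j (δ i e : AffineFunctionField p hp hd)]
      ring
    rw [h1, h0, mul_zero, add_zero]
  -- Dividing `Δ i₀ u` by the root `r (bV i₀)` recovers the cofactor. As it is common to all
  -- indices, multiplication by any `ρ (BV i)` gives `Δ i u`.
  let A : LinearMap.ker τ →ₗ[functionField p hp hd] Ω :=
    { toFun := fun u => (π (C (r (bV i₀))))⁻¹ * Δ i₀ u
      map_add' := fun u v => by rw [Submodule.coe_add, hΔadd, mul_add]
      map_smul' := fun e u => by
        rw [Submodule.coe_smul, hΔsmul _ _ _ u.2, RingHom.id_apply, Algebra.smul_def, hjE,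
          mul_left_comm] }
  have hA : ∀ u : LinearMap.ker τ, (∀ i, π (C (r (bV i))) * A u = Δ i u) ∧ (A u = 0 → u = 0) := by
    intro u
    obtain ⟨z, hz, hz0⟩ := hΔ u u.2
    have hAz : A u = z := by
      change (π (C (r (bV i₀))))⁻¹ * Δ i₀ u = z
      rw [hz, inv_mul_cancel_left₀ hr'0]
    rw [hAz]
    exact ⟨fun i => (hz i).symm, fun h0 => Subtype.ext (hz0 h0)⟩
  refine ⟨Ω, inferInstance, inferInstance, ρ, τ, (hr.map_algebra Ω).liftBaseChange _,
    (hs.map_algebra Ω).liftBaseChange _, ?_, A, ?_, ?_⟩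
  · exact (Submodule.ne_bot_iff _).2 ⟨_, ⟨BV i₀, rfl⟩, by rwa [hρB]⟩
  · rw [injective_iff_map_eq_zero]
    exact fun u => (hA u).2
  · intro x u
    rw [← BV.sum_repr x, map_sum, Finset.sum_mul]
    refine Submodule.sum_mem _ fun i _ => ?_
    rw [map_smul, smul_mul_assoc, hρB, (hA u).1]
    exact Submodule.smul_mem _ _ (hΔrange _ _)

/-- The growth inequality for the ranges of `ρ`, `τ` and `A`, with all dimensions translated into
the invariants of `p` and `q`. -/
theorem firstIsotropyIndex_isotropyIndex_bounds (hp : p.Anisotropic) (hq : q.Anisotropic)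
    (hpl : IsQuasilinear p) (hql : IsQuasilinear q) (hd : 2 ≤ Module.finrank F V) :
    firstIsotropyIndex p hp hd < Module.finrank F V ∧
    2 ^ firstDivisibilityIndex p hp hd ∣ Module.finrank F V - firstIsotropyIndex p hp hd ∧
    (isotropyIndex (baseChange (functionField p hp hd) q) ≤ 2 ^ firstDivisibilityIndex p hp hd ∨
      isotropyIndex (baseChange (functionField p hp hd) q) +
        (Module.finrank F V - firstIsotropyIndex p hp hd) + 2 ^ firstDivisibilityIndex p hp hd ≤
        Module.finrank F W) := by
  obtain ⟨Ω, _, _, ρ, τ, hρ, hτ, hP, A, hA, hAρ⟩ :=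
    exists_squareRoots_functionField hp hq hpl hql hd
  have : CharP (functionField p hp hd) 2 :=
    charP_of_injective_algebraMap (algebraMap F (functionField p hp hd)).injective 2
  have hi₁ : firstIsotropyIndex p hp hd = _ := hρ.isotropyIndex_eq
  have hi₀ := hτ.isotropyIndex_eq
  have hdimp := LinearMap.finrank_range_add_finrank_ker ρ
  have hdimq := LinearMap.finrank_range_add_finrank_ker τ
  rw [Module.finrank_baseChange, ← hi₁] at hdimp
  rw [Module.finrank_baseChange, ← hi₀] at hdimq
  have hPpos : 0 < Module.finrank (functionField p hp hd) (LinearMap.range ρ) :=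
    Nat.pos_of_ne_zero fun h => hP (Submodule.finrank_eq_zero.1 h)
  have hd₁ : 2 ^ firstDivisibilityIndex p hp hd =
      Module.finrank (functionField p hp hd) (stabilizer (LinearMap.range ρ)) := by
    -- `divisibilityIndex` itself passes to the anisotropic part, so this part is taken twice here;
    -- the range of the square root does not change.
    obtain ⟨ρ', hρ', -, hrange⟩ := hρ.exists_anisPart
    rw [← finrank_stabilizer_congr hrange]
    exact hρ'.two_pow_divisibilityIndex (by rwa [hrange])
  have hsub : Module.finrank F V - firstIsotropyIndex p hp hd =
      Module.finrank (functionField p hp hd) (LinearMap.range ρ) := by omega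
  refine ⟨by omega, ?_, ?_⟩
  · rw [hsub, hd₁]
    exact ⟨_, finrank_stabilizer_mul_finrank.symm⟩
  · rw [hsub, hd₁]
    by_contra! h
    obtain ⟨h1, h2⟩ := h
    have hAfin : Module.finrank (functionField p hp hd) (LinearMap.range A) =
        isotropyIndex (baseChange (functionField p hp hd) q) := by
      rw [LinearMap.finrank_range_of_inj hA, hi₀]
    have := finrank_add_finrank_stabilizer_le (LinearMap.range ρ) (LinearMap.range τ)
      (LinearMap.range A) hP (by
        rintro _ ⟨x, rfl⟩ _ ⟨u, rfl⟩
        exact hAρ x u) (by rwa [hAfin])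
    omega

end FunctionField

end QuasilinearForms

/-! ### Deduction of the bounds -/

theorem corollary6p10 {F : Type*} [Field F] [CharP F 2]
    {V : Type*} [AddCommGroup V] [Module F V] [FiniteDimensional F V]
    {W : Type*} [AddCommGroup W] [Module F W] [FiniteDimensional F W]
    (p : QuadraticForm F V) (q : QuadraticForm F W)
    (hp : p.Anisotropic) (hq : q.Anisotropic)
    (hpl : QuasilinearForms.IsQuasilinear p) (hql : QuasilinearForms.IsQuasilinear q)
    (hpd : 2 ≤ Module.finrank F V) (hqd : 2 ≤ Module.finrank F W) :
    let i₁ : ℕ := QuasilinearForms.firstIsotropyIndex p hp hpd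
    let d₁ : ℕ := QuasilinearForms.firstDivisibilityIndex p hp hpd
    let i₀ : ℕ := QuasilinearForms.isotropyIndex
      (QuasilinearForms.baseChange (QuasilinearForms.functionField p hp hpd) q)
    let s : ℕ := padicValNat 2 (Module.finrank F V - i₁)
    -- the number `dim p - i₁` whose 2-adic order is taken is a positive integer
    i₁ < Module.finrank F V ∧
    i₁ ≤ 2 ^ d₁ ∧
    (i₀ : ℤ) ≤ max ((Module.finrank F W : ℤ) - Module.finrank F V + i₁ - 2 ^ d₁) (2 ^ d₁) ∧
    (i₀ : ℤ) ≤ max ((Module.finrank F W : ℤ) - Module.finrank F V) (2 ^ d₁) ∧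
    max ((Module.finrank F W : ℤ) - Module.finrank F V) (2 ^ d₁) ≤
      max ((Module.finrank F W : ℤ) - Module.finrank F V) (2 ^ s) := by
  intro i₁ d₁ i₀ s
  obtain ⟨hlt, hdvd, -⟩ :=
    QuasilinearForms.firstIsotropyIndex_isotropyIndex_bounds hp hq hpl hql hpd
  obtain ⟨-, -, hpp⟩ := QuasilinearForms.firstIsotropyIndex_isotropyIndex_bounds hp hp hpl hpl hpd
  obtain ⟨-, -, hpq⟩ := QuasilinearForms.firstIsotropyIndex_isotropyIndex_bounds hp hq hpl hql hpd
  -- The dichotomy for `q = p`: its second alternative would read `dim p + 2 ^ d₁ ≤ dim p`.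
  have h1 : i₁ ≤ 2 ^ d₁ := by
    rcases hpp with h | h
    · exact h
    · have h2 : 0 < 2 ^ d₁ := by positivity
      change i₁ + (Module.finrank F V - i₁) + 2 ^ d₁ ≤ Module.finrank F V at h
      change i₁ < Module.finrank F V at hlt
      omega
  have h2 : d₁ ≤ s := by
    have : Module.finrank F V - i₁ ≠ 0 := Nat.sub_ne_zero_of_lt hlt
    exact (padicValNat_dvd_iff_le this).1 hdvd
  have h3 : (i₀ : ℤ) ≤
      max ((Module.finrank F W : ℤ) - Module.finrank F V + i₁ - 2 ^ d₁) (2 ^ d₁) := by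
    rcases hpq with h | h
    · exact le_max_of_le_right (by exact_mod_cast h)
    · refine le_max_of_le_left ?_
      change i₀ + (Module.finrank F V - i₁) + 2 ^ d₁ ≤ Module.finrank F W at h
      change i₁ < Module.finrank F V at hlt
      zify [hlt.le] at h
      linarith
  have h1' : (i₁ : ℤ) ≤ 2 ^ d₁ := by exact_mod_cast h1
  -- Since `i₁ - 2 ^ d₁ ≤ 0`, the third bound follows from the second; the last comparison is `d₁ ≤
  -- s`.
  refine ⟨hlt, h1, h3, h3.trans (max_le_max ?_ le_rfl), max_le_max le_rfl ?_⟩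
  · linarith
  · exact pow_le_pow_right₀ one_le_two h2
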